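/- **Model.** There are finitely many users and, for each ordered pair $(i,j)$ of distinct users, a source $X_{ij}$ to be conveyed from $i$ to $j$; source, reproduction, medium-input and medium-output alphabets are finite and time is discrete. Let $\mathcal A$ be a set of such pairs. For $(p,q)\in\mathcal A$ the source is i.i.d. with given marginal, $X_{pq}^n$ is its block of length $n$, and $d_{pq}:\mathcal X_{pq}\times\mathcal Y_{pq}\to[0,\infty)$ is a distortion function; for $(i,j)\notin\mathcal A$ the source is an arbitrary process $(X_{ij}(t))_{t\in\mathbb Z}$. All sources, the common randomness of the users and the initial state of the medium are independent. For block length $n$, the modem $h_i^n$ of user $i$ is, for each time $\tau\ge1$, a transition probability which produces letters $y_{ji}(\tau)$ (for all $j\ne i$) and a medium input $\iota_i(\tau)$ from the blocks $x_{ij}^n$, $(i,j)\in\mathcal A$ (available before time $1$: delay of these sources is immaterial), the letters $x_{ij}(t)$, $t\le\tau-1$, $(i,j)\notin\mathcal A$, the common randomness, and the medium outputs $o_i(t)$ and its own past outputs $y_{ji}(t),\iota_i(t)$, $1\le t\le\tau-1$; for $(j,i)\in\mathcal A$ it moreover forms a final reproduction $Y_{ji}^n\in\mathcal Y_{ji}^n$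 as a function of the whole process $y_{ji}(\cdot)$ and the common randomness. The medium is, for each $\tau\geq 1$, a transition probability which produces the outputs $o_i(\tau)$ at all users from its initial state and all $\iota_i(t),o_i(t)$, $1\le t\le\tau-1$. Given the past, all modems and the medium act independently. The source $X_{pq}$ is *communicated to within distortion $D$* if $$\lim_{n\to\infty}\Pr\Big(\tfrac1n\sum_{k=1}^n d_{pq}(X^n_{pq}[k],Y^n_{pq}[k])>D\Big)=0 .$$ $R_{X_{pq}}(D)\in[0,\infty]$ is the infimum of the rates $R\ge0$ for which there are source codes $\mathcal X_{pq}^n\to\{1,\dots,\lfloor2^{nR}\rfloor\}\to\mathcal Y_{pq}^n$ whose probability of average distortion $>D$ tends to $0$. A *message modem* is defined as a modem, except that for pairs in $\mathcal A$ a message from a finite set takes the place of the source block and a decoded message that of the final reproduction. **Theorem.** Let $h_i^n$ be modems, and for $(p,q)\in\mathcal A$ let $D'_{pq}>D_{pq}$ satisfy $R_{X_{pq}}(D'_{pq})<R_{X_{pq}}(D_{pq})$. Then there are additional common randomness $C'_n$ (independent of everything else), rates $R_{pq}$ with $R_{X_{pq}}(D'_{pq})<R_{pq}<R_{X_{pq}}(D_{pq})$,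 source codes $(s^n_{e,pq},s^n_{d,pq})$ with $\lfloor 2^{nR_{pq}}\rfloor$ messages which compress $X_{pq}$ to within distortion $D'_{pq}$ (the probability that the average distortion between $X_{pq}^n$ and $s^n_{d,pq}(s^n_{e,pq}(X_{pq}^n))$ exceeds $D'_{pq}$ tends to $0$), message modems $g_i^n$ for these message sets, and modems ${h'}_i^n$, none of them depending on the medium, such that: 1. ${h'}_i^n$ has the separation architecture: it source-codes each block $X_{ij}^n$, $(i,j)\in\mathcal A$, by $s^n_{e,ij}$, applies $g_i^n$ to the resulting messages, and applies $s^n_{d,ji}$ to the message decoded by $g_i^n$ for each $(j,i)\in\mathcal A$. If user $i$ belongs to no pair of $\mathcal A$, then ${h'}_i^n$ acts as $h_i^n$. 2. For every medium over which the modems $h_i^n$ communicate $X_{pq}$ to within distortion $D_{pq}$ for all $(p,q)\in\mathcal A$: * the modems $g_i^n$ communicate the messages reliably: for each $(p,q)\in\mathcal A$, the maximum over all messages (of $(p,q)$ and of the other pairs in $\mathcal A$) of the probability that the message of $(p,q)$ is decoded wrongly tends to $0$ as $n\to\infty$; * the modems ${h'}_i^n$ communicate $X_{pq}$ to within distortion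 $D'_{pq}$ for all $(p,q)\in\mathcal A$; * for all $n$ and $i$, the energy and bandwidth use of ${h'}_i^n$ is that of $h_i^n$: the medium input process of user $i$ has the same law under both sets of modems; * for all $n$, every source $X_{ij}$, $(i,j)\notin\mathcal A$, is received as before: the joint law of all $(X_{ij}(\cdot),Y_{ij}(\cdot))$, $(i,j)\notin\mathcal A$, where $Y_{ij}(\cdot)$ is the process of the letters $y_{ij}(\tau)$, $\tau\ge1$, and of all medium inputs and outputs is the same under both sets of modems. -/

import Mathlib

open MeasureTheory ProbabilityTheory Filter Topology
open scoped ENNReal NNReal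

namespace UnknownNetwork

/-! ### Rate-distortion -/

section RateDistortion

variable {X Y : Type}

/-- Average additive distortion `(1/n) ∑ₖ d(x[k], y[k])` between two blocks of length `n`. -/
noncomputable def avgDistortion (d : X → Y → ℝ≥0) {n : ℕ} (x : Fin n → X) (y : Fin n → Y) : ℝ :=
  (∑ k, (d (x k) (y k) : ℝ)) / n

/-- Number `⌊2 ^ (n R)⌋` of messages of a rate `R` code (in bits) of block length `n`. -/
noncomputable def msgCount (R : ℝ≥0) (n : ℕ) : ℕ := ⌊(2 : ℝ) ^ ((n : ℝ) * (R : ℝ))⌋₊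

variable [MeasurableSpace X]

/-- The source code `(enc, dec)` compresses the i.i.d. `μ` source to within distortion `D`: the
probability of excess distortion tends to `0` with the block length. -/
def CompressesWithin (μ : Measure X) (d : X → Y → ℝ≥0) (D : ℝ) {M : ℕ → ℕ}
    (enc : ∀ n, (Fin n → X) → Fin (M n)) (dec : ∀ n, Fin (M n) → (Fin n → Y)) : Prop :=
  Tendsto (fun n : ℕ => (Measure.pi fun _ : Fin n => μ)
    {x | D < avgDistortion d x (dec n (enc n x))}) atTop (𝓝 0)

/-- Rate `R` suffices to compress the i.i.d. `μ` source to within distortion `D`. -/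
def IsAchievableRate (μ : Measure X) (d : X → Y → ℝ≥0) (D : ℝ) (R : ℝ≥0) : Prop :=
  ∃ (enc : ∀ n, (Fin n → X) → Fin (msgCount R n)) (dec : ∀ n, Fin (msgCount R n) → (Fin n → Y)),
    CompressesWithin μ d D enc dec

/-- The rate-distortion function: the infimum of the achievable rates (`∞` if there is none). -/
noncomputable def rateDistortion (μ : Measure X) (d : X → Y → ℝ≥0) (D : ℝ) : ℝ≥0∞ :=
  ⨅ (R : ℝ≥0) (_ : IsAchievableRate μ d D R), (R : ℝ≥0∞)

end RateDistortion

/-! ### Users, signals, modems, medium -/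

/-- Ordered pairs `(i, j)` of distinct users: source `X_ij` goes from user `i` to user `j`. -/
abbrev UserPair (U : Type) := {p : U × U // p.1 ≠ p.2}

/-- The sending user of a pair. -/
abbrev UserPair.src {U : Type} (p : UserPair U) : U := p.1.1

/-- The receiving user of a pair. -/
abbrev UserPair.dst {U : Type} (p : UserPair U) : U := p.1.2

section Model

variable {U : Type}

/-- What the modem at user `i` emits at one time: a reproduction letter `y_ji` for every pair
`(j, i)`, and a medium input letter `ι_i`. -/
abbrev ModemOut (𝒴 : UserPair U → Type) (I : U → Type) (i : U) :=
  (∀ p : {p : UserPair U // p.dst = i}, 𝒴 p.1) × I i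

/-- All signals in the network at one time: the emissions of all modems and the medium outputs
`o_i` at all users. -/
abbrev Signal (𝒴 : UserPair U → Type) (I O : U → Type) :=
  (∀ i, ModemOut 𝒴 I i) × (∀ i, O i)

/-- What the modem at user `i` knows when it emits its letters of time `k + 1`:
* for the pairs `(i, j) ∈ A`, the data `In` to be conveyed (a source block or a message);
* for the pairs `(i, j) ∉ A`, the source letters `x_ij(t)`, `-∞ < t ≤ k`;
* the common randomness `c`;
* the medium outputs `o_i(t)`, `1 ≤ t ≤ k`;
* its own past reproductions `y_ji(t)` and medium inputs `ι_i(t)`, `1 ≤ t ≤ k`.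

The index `j : Fin k` stands for the time `j + 1`.

The data of a pair in `A` are handed over before the first use of the medium, that is, the block
occupies the times `-n+1, …, 0` (delays of the pairs in `A` are immaterial). A modem which uses the
letters of a block one at a time, as they become available, is a special case. -/
abbrev ModemView (A : Finset (UserPair U)) (In : A → Type) (𝒳 𝒴 : UserPair U → Type)
    (I O : U → Type) (C : Type) (i : U) (k : ℕ) :=
  (∀ p : {p : A // p.1.src = i}, In p.1) ×
  (∀ p : {p : {p : UserPair U // p ∉ A} // p.1.src = i}, Set.Iic (k : ℤ) → 𝒳 p.1.1) ×
  C × (Fin k → O i) × (Fin k → ModemOut 𝒴 I i)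

section Modem

variable (A : Finset (UserPair U)) (In Out : A → Type) (𝒳 𝒴 : UserPair U → Type)
  (I O : U → Type) (C : Type)
  [∀ p, MeasurableSpace (In p)] [∀ p, MeasurableSpace (Out p)]
  [∀ p, MeasurableSpace (𝒳 p)] [∀ p, MeasurableSpace (𝒴 p)]
  [∀ i, MeasurableSpace (I i)] [∀ i, MeasurableSpace (O i)] [MeasurableSpace C]

/-- A modem at user `i`: at every time a transition probability from what user `i` knows to what
it emits and, for every pair `(j, i) ∈ A`, a map which forms the final decoding of the data of that
pair from the reproduction process `y_ji(·)` and the common randomness. Decoding need not be causal.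
The plain readout `y_ji[k] = y_ji(t_k)` at prescribed times `t_k` is a special case. -/
structure Modem (i : U) where
  /-- The transition probability for the emissions of time `k + 1`. -/
  step : ∀ k : ℕ, Kernel (ModemView A In 𝒳 𝒴 I O C i k) (ModemOut 𝒴 I i)
  markov : ∀ k, IsMarkovKernel (step k)
  /-- The final decoding for a pair of `A` which ends at `i`. -/
  read : ∀ p : {p : A // p.1.dst = i}, (ℕ → 𝒴 p.1.1) × C → Out p.1
  measurable_read : ∀ p, Measurable (read p)

/-- The medium, with a random initial state in `S`: at every time a transition probability for the
outputs `o_i(k + 1)` at all users, given the initial state, all inputs `ι_i(t)` and all outputs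
`o_i(t)`, `1 ≤ t ≤ k`. -/
structure Medium (S : Type) [MeasurableSpace S] where
  /-- The law of the initial state. -/
  init : Measure S
  isProbabilityMeasure_init : IsProbabilityMeasure init
  /-- The transition probability for the outputs of time `k + 1`. -/
  step : ∀ k : ℕ, Kernel (S × (Fin k → ∀ i, I i) × (Fin k → ∀ i, O i)) (∀ i, O i)
  markov : ∀ k, IsMarkovKernel (step k)

end Modem

attribute [instance] Modem.markov Medium.isProbabilityMeasure_init Medium.markov

/-- The separation architecture `dec ∘ g ∘ enc` at user `i`: the data to be sent are first encoded
into messages by `enc`, the modem `g` communicates messages, and the messages decoded by `g` are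
finally decoded by `dec`. -/
noncomputable def Modem.withSourceCode {A : Finset (UserPair U)} {In Out Msg : A → Type}
    {𝒳 𝒴 : UserPair U → Type} {I O : U → Type} {C : Type}
    [∀ p, MeasurableSpace (In p)] [∀ p, DiscreteMeasurableSpace (In p)]
    [∀ p, MeasurableSpace (Out p)]
    [∀ p, MeasurableSpace (Msg p)] [∀ p, DiscreteMeasurableSpace (Msg p)]
    [∀ p, MeasurableSpace (𝒳 p)] [∀ p, MeasurableSpace (𝒴 p)]
    [∀ i, MeasurableSpace (I i)] [∀ i, MeasurableSpace (O i)] [MeasurableSpace C] {i : U}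
    (g : Modem A Msg Msg 𝒳 𝒴 I O C i)
    (enc : ∀ p, In p → Msg p) (dec : ∀ p, Msg p → Out p) : Modem A In Out 𝒳 𝒴 I O C i where
  step k := (g.step k).comap (fun v => (fun p => enc p.1 (v.1 p), v.2))
    ((measurable_pi_lambda _ fun p =>
      (Measurable.of_discrete (f := enc p.1)).comp
        ((measurable_pi_apply p).comp measurable_fst)).prodMk measurable_snd)
  markov _ := inferInstance
  read p w := dec p.1 (g.read p w)
  measurable_read p := Measurable.of_discrete.comp (g.measurable_read p)

/-! ### The law of the interconnected system -/

/-- The primitive variables: the data of the pairs in `A`, the other sources (processes over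
`-∞ < t < ∞`), the common randomness, and the initial state of the medium. -/
abbrev Primitive (A : Finset (UserPair U)) (In : A → Type) (𝒳 : UserPair U → Type)
    (C S : Type) :=
  (∀ p, In p) × (∀ p : {p : UserPair U // p ∉ A}, ℤ → 𝒳 p.1) × C × S

lemma measurable_pi_measure {ι α : Type} [Fintype ι] {β : ι → Type} [MeasurableSpace α]
    [∀ i, MeasurableSpace (β i)] (κ : ∀ i, Kernel α (β i)) [∀ i, IsMarkovKernel (κ i)] :
    Measurable fun a => Measure.pi fun i => κ i a := by
  refine Measurable.measure_of_isPiSystem_of_isProbabilityMeasure generateFrom_pi.symm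
    isPiSystem_pi ?_
  rintro _ ⟨s, hs, rfl⟩
  simp only [Set.mem_pi, Set.mem_univ, true_implies, Set.mem_ofPred_eq] at hs
  simp only [Measure.pi_pi]
  exact Finset.measurable_prod _ fun i _ => Kernel.measurable_coe (κ i) (hs i)

/-- The independent product of finitely many transition probabilities. -/
noncomputable def piKernel {ι α : Type} [Fintype ι] {β : ι → Type} [MeasurableSpace α]
    [∀ i, MeasurableSpace (β i)] (κ : ∀ i, Kernel α (β i)) [∀ i, IsMarkovKernel (κ i)] :
    Kernel α (∀ i, β i) where
  toFun a := Measure.pi fun i => κ i a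
  measurable' := measurable_pi_measure κ

instance {ι α : Type} [Fintype ι] {β : ι → Type} [MeasurableSpace α]
    [∀ i, MeasurableSpace (β i)] (κ : ∀ i, Kernel α (β i)) [∀ i, IsMarkovKernel (κ i)] :
    IsMarkovKernel (piKernel κ) :=
  ⟨fun a => inferInstanceAs (IsProbabilityMeasure (Measure.pi fun i => κ i a))⟩

section Run

variable {P Sig : Type}

/-- Stage `0` holds the primitive variables, stage `t ≥ 1` the signals of time `t`. -/
def Stage (P Sig : Type) : ℕ → Type
  | 0 => P
  | _ + 1 => Sig

/-- The primitive variables and the signals of the times `1, …, k`, read off the stages `0, …, k`. -/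
def unpack {k : ℕ} (w : ∀ j : Finset.Iic k, Stage P Sig j) : P × (Fin k → Sig) :=
  (w ⟨0, by simp⟩, fun j => w ⟨j.1 + 1, by simp⟩)

variable [MeasurableSpace P] [MeasurableSpace Sig]

instance : ∀ t, MeasurableSpace (Stage P Sig t)
  | 0 => inferInstanceAs (MeasurableSpace P)
  | _ + 1 => inferInstanceAs (MeasurableSpace Sig)

lemma measurable_unpack (k : ℕ) : Measurable (unpack (P := P) (Sig := Sig) (k := k)) :=
  (measurable_pi_apply (⟨0, by simp⟩ : Finset.Iic k)).prodMk
    (measurable_pi_lambda _ fun j =>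
      measurable_pi_apply (⟨j.1 + 1, by simp⟩ : Finset.Iic k))

/-- A transition probability for the signals of time `k + 1`, in terms of stages. -/
noncomputable def stageKernel {k : ℕ} (κ : Kernel (P × (Fin k → Sig)) Sig) :
    Kernel (∀ j : Finset.Iic k, Stage P Sig j) (Stage P Sig (k + 1)) :=
  κ.comap unpack (measurable_unpack k)

instance {k : ℕ} (κ : Kernel (P × (Fin k → Sig)) Sig) [IsMarkovKernel κ] :
    IsMarkovKernel (stageKernel κ) :=
  inferInstanceAs (IsMarkovKernel (κ.comap unpack (measurable_unpack k)))

/-- The primitive variables as stage `0`. -/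
def initialStage (x : P) : ∀ j : Finset.Iic 0, Stage P Sig j
  | ⟨0, _⟩ => x
  | ⟨_ + 1, h⟩ => absurd h (by simp)

lemma measurable_initialStage : Measurable (initialStage (P := P) (Sig := Sig)) :=
  measurable_pi_lambda _ fun j => match j with
    | ⟨0, _⟩ => measurable_id
    | ⟨_ + 1, h⟩ => absurd h (by simp)

/-- The signals of the times `1, 2, …`, that is, all stages but the initial one. -/
def signalStages (w : ∀ t, Stage P Sig t) : ℕ → Sig := fun k => w (k + 1)

lemma measurable_signalStages : Measurable (signalStages (P := P) (Sig := Sig)) :=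
  measurable_pi_lambda _ fun k => measurable_pi_apply (k + 1)

/-- The law of the whole signal process (index `k` stands for time `k + 1`) as a transition
probability from the primitive variables, when the signals of time `k + 1` are produced by `κ k`
from the primitive variables and the signals of the times `1, …, k` (Ionescu-Tulcea). -/
noncomputable def run (κ : ∀ k : ℕ, Kernel (P × (Fin k → Sig)) Sig) [∀ k, IsMarkovKernel (κ k)] :
    Kernel P (ℕ → Sig) :=
  ((Kernel.traj (fun k => stageKernel (κ k)) 0).map signalStages).comap initialStage
    measurable_initialStage

instance (κ : ∀ k : ℕ, Kernel (P × (Fin k → Sig)) Sig) [∀ k, IsMarkovKernel (κ k)] :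
    IsMarkovKernel (run κ) :=
  have := Kernel.IsMarkovKernel.map (Kernel.traj (fun k => stageKernel (κ k)) 0)
    (measurable_signalStages (P := P) (Sig := Sig))
  inferInstanceAs (IsMarkovKernel (Kernel.comap _ _ measurable_initialStage))

end Run

section System

variable {A : Finset (UserPair U)} {In Out : A → Type}
  {𝒳 𝒴 : UserPair U → Type} {I O : U → Type} {C S : Type}
  [∀ p, MeasurableSpace (In p)] [∀ p, MeasurableSpace (Out p)]
  [∀ p, MeasurableSpace (𝒳 p)] [∀ p, MeasurableSpace (𝒴 p)]
  [∀ i, MeasurableSpace (I i)] [∀ i, MeasurableSpace (O i)] [MeasurableSpace C]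
  [MeasurableSpace S]

/-- The part of the primitive variables and of the past signals which user `i` knows. -/
def localView (i : U) (k : ℕ) (w : Primitive A In 𝒳 C S × (Fin k → Signal 𝒴 I O)) :
    ModemView A In 𝒳 𝒴 I O C i k :=
  (fun p => w.1.1 p.1, fun p t => w.1.2.1 p.1 t, w.1.2.2.1, fun t => (w.2 t).2 i,
    fun t => (w.2 t).1 i)

lemma measurable_localView (i : U) (k : ℕ) : Measurable
    (localView (A := A) (In := In) (𝒳 := 𝒳) (𝒴 := 𝒴) (I := I) (O := O) (C := C) (S := S) i k) := by
  unfold localView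
  fun_prop

lemma measurable_mediumView (k : ℕ) : Measurable
    (fun w : Primitive A In 𝒳 C S × (Fin k → Signal 𝒴 I O) =>
      (w.1.2.2.2, (fun t i => ((w.2 t).1 i).2), fun t => (w.2 t).2)) := by
  fun_prop

variable [Fintype U]

/-- Interconnection of the modems `h i` and the medium `m`: given the past, the modems and the
medium produce their outputs of time `k + 1` independently of each other. -/
noncomputable def systemStep (h : ∀ i, Modem A In Out 𝒳 𝒴 I O C i) (m : Medium I O S) (k : ℕ) :
    Kernel (Primitive A In 𝒳 C S × (Fin k → Signal 𝒴 I O)) (Signal 𝒴 I O) :=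
  (piKernel fun i => ((h i).step k).comap (localView i k) (measurable_localView i k)) ×ₖ
    (m.step k).comap _ (measurable_mediumView k)

instance (h : ∀ i, Modem A In Out 𝒳 𝒴 I O C i) (m : Medium I O S) (k : ℕ) :
    IsMarkovKernel (systemStep h m k) := by
  unfold systemStep; infer_instance

/-- A realization of the primitive variables and of the signals of all times. -/
abbrev Realization (A : Finset (UserPair U)) (In : A → Type) (𝒳 𝒴 : UserPair U → Type)
    (I O : U → Type) (C S : Type) :=
  Primitive A In 𝒳 C S × (ℕ → Signal 𝒴 I O)

variable [DecidableEq U]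

/-- The joint law of all variables, when the data of the pairs in `A` have law `β`, the sources
`X_ij`, `(i, j) ∉ A`, have laws `ν`, the common randomness has law `κ`, and all these and the initial
state of the medium are independent of each other. -/
noncomputable def systemLaw (h : ∀ i, Modem A In Out 𝒳 𝒴 I O C i) (m : Medium I O S)
    (β : Measure (∀ p, In p)) (ν : ∀ p : {p : UserPair U // p ∉ A}, Measure (ℤ → 𝒳 p.1))
    (κ : Measure C) : Measure (Realization A In 𝒳 𝒴 I O C S) :=
  (β.prod ((Measure.pi ν).prod (κ.prod m.init))) ⊗ₘ run (systemStep h m)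

/-- The reproduction process `y_p(·)` of the pair `p`, as emitted by the modem at its receiver. -/
def reproduction (p : UserPair U) (w : Realization A In 𝒳 𝒴 I O C S) : ℕ → 𝒴 p :=
  fun k => ((w.2 k).1 p.dst).1 ⟨p, rfl⟩

/-- The final decoding of the data of a pair `p ∈ A` at its receiver. -/
def decoded (h : ∀ i, Modem A In Out 𝒳 𝒴 I O C i) (p : A)
    (w : Realization A In 𝒳 𝒴 I O C S) : Out p :=
  (h p.1.dst).read ⟨p, rfl⟩ (reproduction p.1 w, w.1.2.2.1)

/-- The medium input process at user `i`. -/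
def mediumInput (i : U) (w : Realization A In 𝒳 𝒴 I O C S) : ℕ → I i :=
  fun k => ((w.2 k).1 i).2

/-- The medium output process at user `i`. -/
def mediumOutput (i : U) (w : Realization A In 𝒳 𝒴 I O C S) : ℕ → O i :=
  fun k => (w.2 k).2 i

/-- All sources `X_ij`, `(i, j) ∉ A`, with their reproduction processes `Y_ij`, together with the
medium inputs and medium outputs of all users. -/
def unaffected (w : Realization A In 𝒳 𝒴 I O C S) :
    (∀ p : {p : UserPair U // p ∉ A}, (ℤ → 𝒳 p.1) × (ℕ → 𝒴 p.1)) ×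
      (∀ i, (ℕ → I i) × (ℕ → O i)) :=
  (fun p => (w.1.2.1 p, reproduction p.1 w), fun i => (mediumInput i w, mediumOutput i w))

end System

/-! ### Communication of sources and messages -/

section Communication

variable [Fintype U] [DecidableEq U] {A : Finset (UserPair U)}
  {𝒳 𝒴 : UserPair U → Type} {I O : U → Type} {C : ℕ → Type} {S : Type}
  [∀ p, MeasurableSpace (𝒳 p)] [∀ p, MeasurableSpace (𝒴 p)]
  [∀ i, MeasurableSpace (I i)] [∀ i, MeasurableSpace (O i)] [∀ n, MeasurableSpace (C n)]
  [MeasurableSpace S]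

/-- Modem at user `i` for block length `n`, which communicates source blocks `x_p^n`, `p ∈ A`. -/
abbrev SourceModem (A : Finset (UserPair U)) (𝒳 𝒴 : UserPair U → Type) (I O : U → Type) (C : Type)
    [∀ p, MeasurableSpace (𝒳 p)] [∀ p, MeasurableSpace (𝒴 p)]
    [∀ i, MeasurableSpace (I i)] [∀ i, MeasurableSpace (O i)] [MeasurableSpace C] (n : ℕ) (i : U) :=
  Modem A (fun p => Fin n → 𝒳 p.1) (fun p => Fin n → 𝒴 p.1) 𝒳 𝒴 I O C i

/-- Modem at user `i` which communicates messages from sets of `M p` elements, `p ∈ A`. -/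
abbrev MessageModem (A : Finset (UserPair U)) (𝒳 𝒴 : UserPair U → Type) (I O : U → Type) (C : Type)
    [∀ p, MeasurableSpace (𝒳 p)] [∀ p, MeasurableSpace (𝒴 p)]
    [∀ i, MeasurableSpace (I i)] [∀ i, MeasurableSpace (O i)] [MeasurableSpace C]
    (M : A → ℕ) (i : U) :=
  Modem A (fun p => Fin (M p)) (fun p => Fin (M p)) 𝒳 𝒴 I O C i

/-- The joint law of the system of block length `n` when, for `p ∈ A`, the source `X_p` is i.i.d.
with marginal `μ p`. -/
noncomputable def sourceLaw {C : Type} [MeasurableSpace C] {n : ℕ}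
    (h : ∀ i, SourceModem A 𝒳 𝒴 I O C n i) (m : Medium I O S)
    (μ : ∀ p : A, Measure (𝒳 p.1)) (ν : ∀ p : {p : UserPair U // p ∉ A}, Measure (ℤ → 𝒳 p.1))
    (κ : Measure C) : Measure (Realization A (fun p => Fin n → 𝒳 p.1) 𝒳 𝒴 I O C S) :=
  systemLaw h m (Measure.pi fun p => Measure.pi fun _ : Fin n => μ p) ν κ

/-- The source `X_p`, `p ∈ A`, is communicated to within distortion `D`: the probability of excess
distortion tends to `0` as the block length tends to infinity. -/
def CommunicatesWithin (h : ∀ n i, SourceModem A 𝒳 𝒴 I O (C n) n i) (m : Medium I O S)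
    (μ : ∀ p : A, Measure (𝒳 p.1)) (ν : ∀ p : {p : UserPair U // p ∉ A}, Measure (ℤ → 𝒳 p.1))
    (κ : ∀ n, Measure (C n)) (p : A) (d : 𝒳 p.1 → 𝒴 p.1 → ℝ≥0) (D : ℝ) : Prop :=
  Tendsto (fun n => sourceLaw (h n) m μ ν (κ n)
    {w | D < avgDistortion d (w.1.1 p) (decoded (h n) p w)}) atTop (𝓝 0)

/-- Reliable communication of messages under the maximal block error probability criterion: the
probability that the message of the pair `p ∈ A` is decoded wrongly, maximized over that message
(and over the messages of all other pairs), tends to `0` as the block length tends to infinity. -/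
def CommunicatesReliably {M : ℕ → A → ℕ} (g : ∀ n i, MessageModem A 𝒳 𝒴 I O (C n) (M n) i)
    (m : Medium I O S) (ν : ∀ p : {p : UserPair U // p ∉ A}, Measure (ℤ → 𝒳 p.1))
    (κ : ∀ n, Measure (C n)) (p : A) : Prop :=
  Tendsto (fun n => ⨆ msg : ∀ q, Fin (M n q),
    systemLaw (g n) m (Measure.dirac msg) ν (κ n) {w | decoded (g n) p w ≠ msg p}) atTop (𝓝 0)

end Communication
end Model
end UnknownNetwork

open UnknownNetwork

/-!
Draw a codeword with the law of a source block for every pair in `A` and every message, publish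
this codebook as the additional common randomness, and let the given modems send codewords in
place of source blocks. The codewords sent have the law of the source blocks, so the network
behaves as before: the medium inputs and the other sources are unaffected, and the block which the
given modems reproduce is within `D` of the codeword sent. The receiver decodes to the typical
codeword within `D` of that block.

The competing codewords are independent of the reproduced block, so the decoder fails rarely if
`2 ^ (n * R)` of them are unlikely to match it, where `R` is less than the rate-distortion function
at `D`. Otherwise a single reproduction block would be within `D` of typical blocks of total
probability more than `2 ^ (-n * R')`, where `R'` is still less than the rate-distortion function
at `D`. About `2 ^ (n * R')` rearrangements of this block then cover all typical blocks up to a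
small Hamming distance. This distance costs a little distortion, which is removed by modifying the
reproductions in few places. The result is a source code of a rate at which there is none.
-/

namespace UnknownNetwork

/-! ### Change of the primitive variables -/

section StageMap

variable {P P' Sig : Type}

/-- A map of the primitive variables as a map of stages; the signals are kept. -/
def stageMap (φ : P → P') : ∀ t, Stage P Sig t → Stage P' Sig t
  | 0 => φ
  | _ + 1 => id

variable {φ : P → P'}

lemma piMap_stageMap_initialStage (x : P) :
    Pi.map (fun j : Finset.Iic 0 => stageMap (Sig := Sig) φ j) (initialStage x) =
      initialStage (φ x) := by
  funext ⟨j, hj⟩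
  obtain rfl : j = 0 := by simpa using hj
  rfl

variable [MeasurableSpace P] [MeasurableSpace P'] [MeasurableSpace Sig]

lemma measurable_stageMap (hφ : Measurable φ) : ∀ t, Measurable (stageMap (Sig := Sig) φ t)
  | 0 => hφ
  | _ + 1 => measurable_id

lemma measurable_piMap_stageMap (hφ : Measurable φ) {ι : Type} (t : ι → ℕ) :
    Measurable (Pi.map fun i => stageMap (Sig := Sig) φ (t i)) :=
  measurable_pi_lambda _ fun i => (measurable_stageMap hφ (t i)).comp (measurable_pi_apply i)

lemma partialTraj_succ_self_apply {X : ℕ → Type*} [∀ n, MeasurableSpace (X n)]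
    (κ : ∀ n, Kernel (∀ i : Finset.Iic n, X i) (X (n + 1))) [∀ n, IsMarkovKernel (κ n)] (n : ℕ)
    (u : ∀ i : Finset.Iic n, X i) :
    Kernel.partialTraj κ n (n + 1) u =
      (κ n u).map fun v => IicProdIoc n (n + 1) (u, MeasurableEquiv.piSingleton n v) := by
  rw [Kernel.partialTraj_succ_self, Kernel.map_apply _ (by fun_prop), Kernel.prod_apply,
    Kernel.id_apply, Kernel.map_apply _ (by fun_prop), Measure.dirac_prod,
    Measure.map_map (by fun_prop) (by fun_prop), Measure.map_map (by fun_prop) (by fun_prop)]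
  rfl

variable (hφ : Measurable φ) (κ : ∀ k : ℕ, Kernel (P' × (Fin k → Sig)) Sig)
  [∀ k, IsMarkovKernel (κ k)]

include hφ in
lemma measurable_prodMap_stages (k : ℕ) :
    Measurable (Prod.map φ (id : (Fin k → Sig) → (Fin k → Sig))) :=
  hφ.prodMap measurable_id

lemma map_partialTraj_succ_self_stageMap (n : ℕ) (u : ∀ j : Finset.Iic n, Stage P Sig j) :
    (Kernel.partialTraj
        (fun k => stageKernel ((κ k).comap _ (measurable_prodMap_stages hφ k))) n (n + 1) u).map
        (Pi.map fun j : Finset.Iic (n + 1) => stageMap φ j) =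
      Kernel.partialTraj (fun k => stageKernel (κ k)) n (n + 1)
        (Pi.map (fun j : Finset.Iic n => stageMap φ j) u) := by
  rw [partialTraj_succ_self_apply, partialTraj_succ_self_apply,
    Measure.map_map (measurable_piMap_stageMap hφ _) (by fun_prop)]
  refine congrArg₂ Measure.map ?_ rfl
  funext z ⟨j, hj⟩
  simp only [Function.comp_apply, Pi.map_apply, IicProdIoc]
  split_ifs with hjn
  · rfl
  · obtain rfl : j = n + 1 := by simp only [Finset.mem_Iic] at hj hjn; omega
    rfl

lemma map_partialTraj_stageMap (n : ℕ) (u : ∀ j : Finset.Iic 0, Stage P Sig j) :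
    (Kernel.partialTraj
        (fun k => stageKernel ((κ k).comap _ (measurable_prodMap_stages hφ k))) 0 n u).map
        (Pi.map fun j : Finset.Iic n => stageMap φ j) =
      Kernel.partialTraj (fun k => stageKernel (κ k)) 0 n
        (Pi.map (fun j : Finset.Iic 0 => stageMap φ j) u) := by
  induction n with
  | zero =>
    simp only [Kernel.partialTraj_self, Kernel.id_apply]
    exact Measure.map_dirac' (measurable_piMap_stageMap hφ _) u
  | succ n ih =>
    have hm (k : ℕ) := measurable_piMap_stageMap (Sig := Sig) hφ fun j : Finset.Iic k => (j : ℕ)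
    rw [Kernel.partialTraj_succ_eq_comp n.zero_le, Kernel.partialTraj_succ_eq_comp n.zero_le,
      Kernel.comp_apply, Kernel.comp_apply, ← ih, Measure.map_comp _ _ (hm _)]
    ext s hs
    rw [Measure.bind_apply hs (Kernel.aemeasurable _),
      Measure.bind_apply hs (Kernel.aemeasurable _),
      lintegral_map (Kernel.measurable_coe _ hs) (hm _)]
    refine lintegral_congr fun v => ?_
    rw [Kernel.map_apply _ (hm _), map_partialTraj_succ_self_stageMap hφ κ]

lemma map_traj_stageMap (u : ∀ j : Finset.Iic 0, Stage P Sig j) :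
    (Kernel.traj (fun k => stageKernel ((κ k).comap _ (measurable_prodMap_stages hφ k))) 0 u).map
        (Pi.map fun t => stageMap φ t) =
      Kernel.traj (fun k => stageKernel (κ k)) 0
        (Pi.map (fun j : Finset.Iic 0 => stageMap φ j) u) := by
  refine ((Kernel.isProjectiveLimit_trajFun (fun k => stageKernel (κ k)) 0 _).unique ?_).symm
  rw [isProjectiveLimit_nat_iff (Kernel.isProjectiveMeasureFamily_partialTraj _ _)]
  intro n
  rw [inducedFamily_Iic, Measure.map_map (by fun_prop) (measurable_piMap_stageMap hφ _),
    ← map_partialTraj_stageMap hφ κ, ← Kernel.traj_map_frestrictLe_apply,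
    Measure.map_map (measurable_piMap_stageMap hφ _) (by fun_prop)]
  rfl

lemma run_eq_comap {κ : ∀ k : ℕ, Kernel (P' × (Fin k → Sig)) Sig} [∀ k, IsMarkovKernel (κ k)]
    {κ' : ∀ k : ℕ, Kernel (P × (Fin k → Sig)) Sig} [∀ k, IsMarkovKernel (κ' k)]
    (hκ : ∀ k, κ' k = (κ k).comap _ (measurable_prodMap_stages hφ k)) :
    run κ' = (run κ).comap φ hφ := by
  obtain rfl := funext hκ
  ext1 x
  simp only [run, Kernel.comap_apply]
  rw [Kernel.map_apply _ measurable_signalStages, Kernel.map_apply _ measurable_signalStages,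
    ← piMap_stageMap_initialStage, ← map_traj_stageMap hφ κ,
    Measure.map_map measurable_signalStages (measurable_piMap_stageMap hφ _)]
  rfl

end StageMap

section Substitution

variable {P P' Sig V : Type*} [MeasurableSpace P] [MeasurableSpace P'] [MeasurableSpace Sig]
  [MeasurableSpace V]

lemma map_compProd_comap (π : Measure P) [SFinite π] (κ : Kernel P' Sig) [IsSFiniteKernel κ]
    {φ : P → P'} (hφ : Measurable φ) :
    (π ⊗ₘ κ.comap φ hφ).map (Prod.map φ id) = π.map φ ⊗ₘ κ := by
  ext s hs
  rw [Measure.map_apply (by fun_prop) hs, Measure.compProd_apply (hs.preimage (by fun_prop)),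
    Measure.compProd_apply hs, lintegral_map (Kernel.measurable_kernel_prodMk_left hs) hφ]
  rfl

lemma prod_compProd_prodMkLeft (ζ : Measure V) [SFinite ζ] (π : Measure P) [SFinite π]
    (κ : Kernel P Sig) [IsSFiniteKernel κ] :
    (ζ.prod π ⊗ₘ κ.prodMkLeft V).map MeasurableEquiv.prodAssoc = ζ.prod (π ⊗ₘ κ) := by
  rw [← Measure.compProd_const, Measure.compProd_assoc', ← Measure.compProd_const]
  congr 1
  ext1 v
  ext s hs
  rw [Kernel.compProd_apply hs, Kernel.const_apply, Kernel.const_apply, Measure.compProd_apply hs]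
  rfl

lemma map_compProd_comap_prod (π : Measure P) [SFinite π] (ζ : Measure V) [SFinite ζ]
    (π' : Measure P') [SFinite π'] (κ : Kernel P' Sig) [IsSFiniteKernel κ] {u : P → V}
    {φ : P → P'} (hu : Measurable u) (hφ : Measurable φ)
    (h : π.map (fun x => (u x, φ x)) = ζ.prod π') :
    (π ⊗ₘ κ.comap φ hφ).map (fun w => (u w.1, Prod.map φ id w)) = ζ.prod (π' ⊗ₘ κ) := by
  rw [← prod_compProd_prodMkLeft, ← h, ← map_compProd_comap _ _ (hu.prodMk hφ),
    Measure.map_map (by fun_prop) (by fun_prop)]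
  rfl

variable {B N C C' S Z : Type*} [MeasurableSpace B] [MeasurableSpace N] [MeasurableSpace C]
  [MeasurableSpace C'] [MeasurableSpace S] [MeasurableSpace Z]

lemma measurePreserving_prod_leftComm (π : Measure P) [SFinite π] (ν : Measure N) [SFinite ν]
    (σ : Measure S) [SFinite σ] :
    MeasurePreserving (fun w : P × N × S => (w.2.1, w.1, w.2.2))
      (π.prod (ν.prod σ)) (ν.prod (π.prod σ)) :=
  (measurePreserving_prodAssoc ν π σ).comp
    ((Measure.measurePreserving_swap.prod (.id σ)).comp (measurePreserving_prodAssoc π ν σ).symm)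

lemma map_prod_substitute (β : Measure B) [SFinite β] (ν : Measure N) [SFinite ν]
    (κ : Measure C) [SFinite κ] (κ' : Measure C') [SFinite κ'] (σ : Measure S) [SFinite σ]
    {ζ : Measure Z} {G : B × C' → Z} (hG : MeasurePreserving G (β.prod κ') ζ) :
    (β.prod (ν.prod ((κ.prod κ').prod σ))).map
        (fun w => (G (w.1, w.2.2.1.2), w.2.1, w.2.2.1.1, w.2.2.2)) =
      ζ.prod (ν.prod (κ.prod σ)) := by
  have hC' : MeasurePreserving (fun w : N × (C × C') × S => (w.2.1.2, w.1, w.2.1.1, w.2.2))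
      (ν.prod ((κ.prod κ').prod σ)) (κ'.prod (ν.prod (κ.prod σ))) :=
    (measurePreserving_prod_leftComm ν κ' _).comp <| (MeasurePreserving.id ν).prod <|
      (measurePreserving_prodAssoc κ' κ σ).comp (Measure.measurePreserving_swap.prod (.id σ))
  exact ((hG.prod (.id _)).comp <| (measurePreserving_prodAssoc β κ' _).symm.comp <|
    (MeasurePreserving.id β).prod hC').map_eq

lemma measurePreserving_of_ae_map_eq (β : Measure B) [IsProbabilityMeasure β] (κ : Measure C)
    [SFinite κ] {ζ : Measure Z} [SFinite ζ] {G : B × C → Z} (hG : Measurable G)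
    (h : ∀ᵐ b ∂β, κ.map (fun c => G (b, c)) = ζ) : MeasurePreserving G (β.prod κ) ζ :=
  measurePreserving_snd.comp <|
    (MeasurePreserving.id β).skew_product (g := fun b c => G (b, c)) hG h

end Substitution

/-! ### Hamming distance and letter counts -/

section Hamming

variable {ι X : Type*} [Fintype ι]

lemma hammingDist_comp_equiv [DecidableEq X] {κ : Type*} [Fintype κ] (x z : ι → X) (e : κ ≃ ι) :
    hammingDist (x ∘ e) (z ∘ e) = hammingDist x z :=
  Finset.card_equiv e (by simp)

lemma hammingDist_comp_swap_lt [DecidableEq X] [DecidableEq ι] {x z : ι → X} {k l : ι}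
    (hk : x k ≠ z k) (hl : x l = z k) (hzl : z l ≠ z k) :
    hammingDist (x ∘ Equiv.swap k l) z < hammingDist x z := by
  refine Finset.card_lt_card (Finset.ssubset_iff_of_subset (fun j hj => ?_) |>.2 ⟨k, ?_, ?_⟩)
  · simp only [Finset.mem_filter_univ, Function.comp_apply] at hj ⊢
    rcases eq_or_ne j k with rfl | hjk
    · exact hk
    rcases eq_or_ne j l with rfl | hjl
    · exact hl ▸ hzl.symm
    · rwa [Equiv.swap_apply_of_ne_of_ne hjk hjl] at hj
  · simpa using hk
  · simpa using hl

lemma sum_pow_hammingDist {R : Type*} [CommRing R] [DecidableEq X] [Fintype X] [DecidableEq ι]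
    (y : ι → X) (r : R) :
    ∑ y' : ι → X, r ^ hammingDist y' y =
      (1 + (Fintype.card X - 1) * r) ^ Fintype.card ι := by
  have hletter (k : ι) :
      ∑ b, (if b ≠ y k then r else 1) = 1 + ((Fintype.card X : R) - 1) * r := by
    rw [← Finset.add_sum_erase _ _ (Finset.mem_univ (y k)),
      Finset.sum_congr rfl fun b hb => if_pos (Finset.ne_of_mem_erase hb)]
    simp [Nat.cast_sub (Fintype.card_pos_iff.2 ⟨y k⟩)]
  calc ∑ y' : ι → X, r ^ hammingDist y' y
      = ∑ y' : ι → X, ∏ k, (if y' k ≠ y k then r else 1) := by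
        refine Finset.sum_congr rfl fun y' _ => ?_
        rw [hammingDist, ← Finset.prod_const, Finset.prod_filter]
    _ = ∏ k, ∑ b, (if b ≠ y k then r else 1) :=
        (Fintype.prod_sum fun k b => if b ≠ y k then r else 1).symm
    _ = (1 + (Fintype.card X - 1) * r) ^ Fintype.card ι := by
        simp_rw [hletter, Finset.prod_const, Finset.card_univ]

/- The summands of `∑ y', r ^ hammingDist y' y` which belong to the ball are at least `r ^ t`. -/
lemma card_hammingDist_le_mul_pow_le [DecidableEq X] [Fintype X] [DecidableEq ι] (y : ι → X)
    (t : ℕ) {r : ℝ} (hr0 : 0 ≤ r) (hr1 : r ≤ 1) :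
    (Finset.card {y' : ι → X | hammingDist y' y ≤ t} : ℝ) * r ^ t ≤
      (1 + (Fintype.card X - 1) * r) ^ Fintype.card ι := by
  rw [← sum_pow_hammingDist y, ← nsmul_eq_mul, ← Finset.sum_const]
  refine (Finset.sum_le_sum fun y' hy' => ?_).trans <|
    Finset.sum_le_sum_of_subset_of_nonneg (Finset.filter_subset _ _) fun _ _ _ => by positivity
  exact pow_le_pow_of_le_one hr0 hr1 (Finset.mem_filter.1 hy').2

lemma exists_card_hammingDist_le_pow (X : Type*) [DecidableEq X] [Fintype X] {b : ℝ}
    (hb : 1 < b) :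
    ∃ τ : ℝ, 0 < τ ∧ ∀ (n : ℕ) (y : Fin n → X) (t : ℕ), t ≤ τ * n →
      (Finset.card {y' : Fin n → X | hammingDist y' y ≤ t} : ℝ) ≤ b ^ n := by
  have hsqrt : 1 < √b := by rwa [Real.lt_sqrt zero_le_one, one_pow]
  obtain ⟨r, hr, hr0, hr1⟩ : ∃ r : ℝ,
      1 + (Fintype.card X - 1) * r < √b ∧ r ∈ Set.Ioo (0 : ℝ) 1 := by
    have hcont : ContinuousAt (fun r : ℝ => 1 + (Fintype.card X - 1) * r) 0 := by fun_prop
    exact (((hcont.eventually_lt_const (by simpa using hsqrt)).filter_mono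
      nhdsWithin_le_nhds).and (Ioo_mem_nhdsGT one_pos)).exists
  obtain ⟨τ, hτ, hτ0⟩ : ∃ τ : ℝ, r⁻¹ ^ τ < √b ∧ 0 < τ := by
    have hcont : ContinuousAt (fun τ : ℝ => r⁻¹ ^ τ) 0 :=
      Real.continuousAt_const_rpow (inv_pos.2 hr0).ne'
    exact (((hcont.eventually_lt_const (by simpa using hsqrt)).filter_mono
      nhdsWithin_le_nhds).and (self_mem_nhdsWithin (s := Set.Ioi 0))).exists
  refine ⟨τ, hτ0, fun n y t ht => ?_⟩
  have hpow : r⁻¹ ^ t ≤ √b ^ n :=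
    calc r⁻¹ ^ t = r⁻¹ ^ (t : ℝ) := (Real.rpow_natCast _ _).symm
      _ ≤ r⁻¹ ^ (τ * n) :=
        Real.rpow_le_rpow_of_exponent_le ((one_le_inv₀ hr0).2 hr1.le) ht
      _ = (r⁻¹ ^ τ) ^ n := Real.rpow_mul_natCast (by positivity) _ _
      _ ≤ √b ^ n := by gcongr
  have hbase : 0 ≤ 1 + ((Fintype.card X : ℝ) - 1) * r := by
    nlinarith [(Fintype.card X).cast_nonneg (α := ℝ)]
  calc (Finset.card {y' : Fin n → X | hammingDist y' y ≤ t} : ℝ)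
      = (Finset.card {y' : Fin n → X | hammingDist y' y ≤ t} : ℝ) * r ^ t * r⁻¹ ^ t := by
        rw [mul_assoc, ← mul_pow, mul_inv_cancel₀ hr0.ne', one_pow, mul_one]
    _ ≤ (1 + (Fintype.card X - 1) * r) ^ n * √b ^ n := by
        gcongr
        simpa using card_hammingDist_le_mul_pow_le y t hr0.le hr1.le
    _ ≤ √b ^ n * √b ^ n := by gcongr
    _ = b ^ n := by rw [← mul_pow, Real.mul_self_sqrt (zero_le_one.trans hb.le)]

end Hamming

section Occurrences

variable {ι X : Type*} [Fintype ι] [DecidableEq X]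

/-- The number of occurrences of a letter in a block. -/
def occurrences (x : ι → X) (a : X) : ℕ := Finset.card {k | x k = a}

lemma occurrences_comp_equiv {κ : Type*} [Fintype κ] (x : ι → X) (e : κ ≃ ι) :
    occurrences (x ∘ e) = occurrences x :=
  funext fun _ => Finset.card_equiv e (by simp)

lemma occurrences_append {m n : ℕ} (u : Fin m → X) (v : Fin n → X) (a : X) :
    occurrences (Fin.append u v) a = occurrences u a + occurrences v a := by
  simp only [occurrences, Finset.card_filter, Fin.sum_univ_add, Fin.append_left, Fin.append_right]

lemma occurrences_le_card (x : ι → X) (a : X) : occurrences x a ≤ Fintype.card ι :=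
  Finset.card_le_univ _

lemma card_ne_and_eq_le {x z : ι → X} {a : X}
    (h : ∀ k l, x k ≠ a → z k = a → x l = a → z l = a) :
    Finset.card {k | x k ≠ z k ∧ z k = a} ≤ occurrences z a - occurrences x a := by
  classical
  rcases ({k | x k ≠ z k ∧ z k = a} : Finset ι).eq_empty_or_nonempty with hempty | ⟨k, hk⟩
  · simp [hempty]
  obtain ⟨hk, hka⟩ : x k ≠ z k ∧ z k = a := by simpa using hk
  have hsub : ({l | x l = a} : Finset ι) ⊆ ({l | z l = a} : Finset ι) :=
    Finset.monotone_filter_right _ fun l _ hl => h k l (hka ▸ hk) hka hl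
  rw [occurrences, occurrences, ← Finset.card_sdiff_of_subset hsub]
  refine Finset.card_le_card fun l hl => ?_
  simp only [Finset.mem_filter_univ, Finset.mem_sdiff] at hl ⊢
  exact ⟨hl.2, hl.2 ▸ hl.1⟩

/- In a rearrangement `x ∘ σ` which is as close to `z` as possible no swap helps: a letter which is
missing somewhere is never misplaced. -/
lemma exists_perm_hammingDist_le [Fintype X] (x z : ι → X) :
    ∃ σ : Equiv.Perm ι,
      hammingDist (x ∘ σ) z ≤ ∑ a, (occurrences z a - occurrences x a) := by
  classical
  obtain ⟨σ, hσ⟩ := Finite.exists_min fun σ : Equiv.Perm ι => hammingDist (x ∘ σ) z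
  refine ⟨σ, ?_⟩
  rw [hammingDist, Finset.card_eq_sum_card_fiberwise (f := z) (t := Finset.univ) (by simp)]
  refine Finset.sum_le_sum fun a _ => ?_
  rw [Finset.filter_filter, ← occurrences_comp_equiv x σ]
  refine card_ne_and_eq_le fun k l hk hka hl => ?_
  by_contra hzl
  exact (hσ (σ * Equiv.swap k l)).not_gt
    (hammingDist_comp_swap_lt (hka ▸ hk) (hl.trans hka.symm) (hka ▸ hzl))

end Occurrences

section GreedyCover

variable {α β : Type*} [Fintype β] (r : α → β → Prop) (S : Finset α) {ρ : ℝ}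

open Classical in
lemma exists_mul_card_le_card_filter [Nonempty β]
    (h : ∀ a ∈ S, ρ * Fintype.card β ≤ Finset.card {b | r a b}) :
    ∃ b, ρ * S.card ≤ Finset.card {a ∈ S | r a b} := by
  have hdouble : ∑ _b : β, ρ * S.card ≤ ∑ b, (Finset.card {a ∈ S | r a b} : ℝ) :=
    calc ∑ _b : β, ρ * S.card = ∑ _a ∈ S, ρ * Fintype.card β := by
          simp only [Finset.sum_const, nsmul_eq_mul, Finset.card_univ]; ring
      _ ≤ ∑ a ∈ S, (Finset.card {b | r a b} : ℝ) := Finset.sum_le_sum h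
      _ = ∑ b, (Finset.card {a ∈ S | r a b} : ℝ) :=
          mod_cast Finset.sum_card_bipartiteAbove_eq_sum_card_bipartiteBelow r
  obtain ⟨b, -, hb⟩ := Finset.exists_le_of_sum_le Finset.univ_nonempty hdouble
  exact ⟨b, hb⟩

open Classical in
lemma exists_card_filter_forall_not_le [Nonempty β] (hρ : ρ ≤ 1)
    (h : ∀ a ∈ S, ρ * Fintype.card β ≤ Finset.card {b | r a b}) (K : ℕ) :
    ∃ B : Finset β, B.card ≤ K ∧
      (Finset.card {a ∈ S | ∀ b ∈ B, ¬ r a b} : ℝ) ≤ (1 - ρ) ^ K * S.card := by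
  induction K with
  | zero => exact ⟨∅, by simp⟩
  | succ K ih =>
    obtain ⟨B, hBK, hB⟩ := ih
    obtain ⟨b, hb⟩ := exists_mul_card_le_card_filter r {a ∈ S | ∀ b ∈ B, ¬ r a b}
      fun a ha => h a (Finset.mem_of_mem_filter a ha)
    refine ⟨insert b B, (Finset.card_insert_le b B).trans (by gcongr), ?_⟩
    have hinsert : ({a ∈ S | ∀ b' ∈ insert b B, ¬ r a b'} : Finset α) =
        {a ∈ ({a ∈ S | ∀ b ∈ B, ¬ r a b} : Finset α) | ¬ r a b} := by
      simp only [Finset.forall_mem_insert, Finset.filter_filter, and_comm]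
    have hsplit : (Finset.card {a ∈ ({a ∈ S | ∀ b ∈ B, ¬ r a b} : Finset α) | r a b} : ℝ) +
        Finset.card {a ∈ ({a ∈ S | ∀ b ∈ B, ¬ r a b} : Finset α) | ¬ r a b} =
        Finset.card {a ∈ S | ∀ b ∈ B, ¬ r a b} :=
      mod_cast Finset.card_filter_add_card_filter_not fun a => r a b
    rw [hinsert]
    calc (Finset.card {a ∈ ({a ∈ S | ∀ b ∈ B, ¬ r a b} : Finset α) | ¬ r a b} : ℝ)
        ≤ (1 - ρ) * Finset.card {a ∈ S | ∀ b ∈ B, ¬ r a b} := by linarith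
      _ ≤ (1 - ρ) * ((1 - ρ) ^ K * S.card) := by gcongr
      _ = (1 - ρ) ^ (K + 1) * S.card := by ring

open Classical in
lemma exists_cover_of_pow_mul_card_lt_one [Nonempty β] (hρ : ρ ≤ 1)
    (h : ∀ a ∈ S, ρ * Fintype.card β ≤ Finset.card {b | r a b}) {K : ℕ}
    (hK : (1 - ρ) ^ K * S.card < 1) : ∃ B : Finset β, B.card ≤ K ∧ ∀ a ∈ S, ∃ b ∈ B, r a b := by
  obtain ⟨B, hBK, hB⟩ := exists_card_filter_forall_not_le r S hρ h K
  have hempty : ({a ∈ S | ∀ b ∈ B, ¬ r a b} : Finset α) = ∅ := by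
    rw [← Finset.card_eq_zero, ← Nat.lt_one_iff]
    exact_mod_cast hB.trans_lt hK
  refine ⟨B, hBK, fun a ha => ?_⟩
  simpa using Finset.filter_eq_empty_iff.1 hempty ha

end GreedyCover

/-! ### Popular reproduction blocks and codebooks -/

section Averaging

variable {ι X : Type*} [Fintype ι] [Fintype X] {w : X → ℝ}

lemma exists_sum_mul_le_of_mem_stdSimplex (hw : w ∈ stdSimplex ℝ X) (f : X → ℝ) :
    ∃ a, ∑ b, w b * f b ≤ f a := by
  have : Nonempty X := by
    by_contra hX
    have := not_nonempty_iff.1 hX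
    simpa using hw.2
  obtain ⟨a, ha⟩ := Finite.exists_max f
  refine ⟨a, (Finset.sum_le_sum fun b _ => mul_le_mul_of_nonneg_left (ha b) (hw.1 b)).trans_eq ?_⟩
  rw [← Finset.sum_mul, hw.2, one_mul]

lemma le_one_of_mem_stdSimplex (hw : w ∈ stdSimplex ℝ X) (a : X) : w a ≤ 1 :=
  hw.2 ▸ Finset.single_le_sum (fun b _ => hw.1 b) (Finset.mem_univ a)

variable [DecidableEq ι]

lemma prod_mem_stdSimplex (hw : w ∈ stdSimplex ℝ X) :
    (fun x : ι → X => ∏ k, w (x k)) ∈ stdSimplex ℝ (ι → X) := by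
  refine ⟨fun x => Finset.prod_nonneg fun k _ => hw.1 (x k), ?_⟩
  rw [← Fintype.prod_sum (fun (_ : ι) a => w a), Finset.prod_const, hw.2, one_pow]

lemma sum_prod_mul_card_perm [DecidableEq X] (w : X → ℝ) (E : Finset (ι → X)) :
    ∑ z : ι → X, (∏ k, w (z k)) * Finset.card {π : Equiv.Perm ι | z ∘ π ∈ E} =
      (∑ x ∈ E, ∏ k, w (x k)) * Fintype.card (Equiv.Perm ι) := by
  have hperm (π : Equiv.Perm ι) :
      ∑ z : ι → X, (∏ k, w (z k)) * (if z ∘ π ∈ E then 1 else 0) = ∑ x ∈ E, ∏ k, w (x k) :=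
    calc ∑ z : ι → X, (∏ k, w (z k)) * (if z ∘ π ∈ E then 1 else 0)
        = ∑ z : ι → X, (∏ k, w ((z ∘ π) k)) * (if z ∘ π ∈ E then 1 else 0) :=
          Finset.sum_congr rfl fun z _ => by
            rw [← Equiv.prod_comp π fun k => w (z k)]; rfl
      _ = ∑ x : ι → X, (∏ k, w (x k)) * (if x ∈ E then 1 else 0) :=
          Equiv.sum_comp (π.symm.arrowCongr (Equiv.refl X)) fun x : ι → X =>
            (∏ k, w (x k)) * (if x ∈ E then (1 : ℝ) else 0)
      _ = ∑ x ∈ E, ∏ k, w (x k) := by simp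
  calc ∑ z : ι → X, (∏ k, w (z k)) * (Finset.card {π : Equiv.Perm ι | z ∘ π ∈ E} : ℝ)
      = ∑ π : Equiv.Perm ι, ∑ z : ι → X, (∏ k, w (z k)) * (if z ∘ π ∈ E then 1 else 0) := by
        rw [Finset.sum_comm]
        simp only [Finset.card_filter, Nat.cast_sum, Nat.cast_ite, Nat.cast_one, Nat.cast_zero,
          Finset.mul_sum]
    _ = (∑ x ∈ E, ∏ k, w (x k)) * Fintype.card (Equiv.Perm ι) := by
        simp only [hperm, Finset.sum_const, Finset.card_univ, nsmul_eq_mul, mul_comm]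

lemma exists_mul_card_perm_le [DecidableEq X] (hw : w ∈ stdSimplex ℝ X) (E : Finset (ι → X)) :
    ∃ z : ι → X, (∑ x ∈ E, ∏ k, w (x k)) * Fintype.card (Equiv.Perm ι) ≤
      Finset.card {π : Equiv.Perm ι | z ∘ π ∈ E} := by
  rw [← sum_prod_mul_card_perm]
  exact exists_sum_mul_le_of_mem_stdSimplex (prod_mem_stdSimplex hw) _

end Averaging

section Typical

variable {X : Type*} [DecidableEq X] {w : X → ℝ} {m n : ℕ} {c c' : ℝ}

/-- A block is typical for the letter weights `w`, up to the slack `c`, if every letter occurs in it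
as often as expected, up to `c`. -/
def IsTypical (w : X → ℝ) (c : ℝ) (x : Fin n → X) : Prop :=
  ∀ a, |(occurrences x a : ℝ) - n * w a| ≤ c

lemma IsTypical.mono {x : Fin n → X} (hx : IsTypical w c x) (h : c ≤ c') : IsTypical w c' x :=
  fun a => (hx a).trans h

lemma isTypical_comp_perm_iff {x : Fin n → X} (π : Equiv.Perm (Fin n)) :
    IsTypical w c (x ∘ π) ↔ IsTypical w c x := by
  simp only [IsTypical, occurrences_comp_equiv]

lemma IsTypical.append {u : Fin m → X} {v : Fin n → X} (hu : IsTypical w c u)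
    (hv : IsTypical w c' v) : IsTypical w (c + c') (Fin.append u v) := fun a => by
  have hsum : (occurrences (Fin.append u v) a : ℝ) - (m + n : ℕ) * w a =
      ((occurrences u a : ℝ) - m * w a) + (occurrences v a - n * w a) := by
    rw [occurrences_append]; push_cast; ring
  exact hsum ▸ (abs_add_le _ _).trans (add_le_add (hu a) (hv a))

variable [Fintype X]

lemma isTypical_natCast (hw : w ∈ stdSimplex ℝ X) (x : Fin n → X) : IsTypical w n x := fun a => by
  have hocc : (occurrences x a : ℝ) ≤ n := by
    exact_mod_cast (occurrences_le_card x a).trans_eq (Fintype.card_fin n)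
  have hmul : n * w a ≤ n := mul_le_of_le_one_right n.cast_nonneg (le_one_of_mem_stdSimplex hw a)
  have hmul' : 0 ≤ n * w a := mul_nonneg n.cast_nonneg (hw.1 a)
  exact abs_le.2 ⟨by linarith [(occurrences x a).cast_nonneg (α := ℝ)], by linarith⟩

lemma IsTypical.exists_perm_hammingDist_le {x z : Fin n → X} (hx : IsTypical w c x)
    (hz : IsTypical w c z) :
    ∃ σ : Equiv.Perm (Fin n), (hammingDist (x ∘ σ) z : ℝ) ≤ Fintype.card X * (2 * c) := by
  obtain ⟨σ, hσ⟩ := UnknownNetwork.exists_perm_hammingDist_le x z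
  refine ⟨σ, ?_⟩
  calc (hammingDist (x ∘ σ) z : ℝ) ≤ ∑ a, ((occurrences z a - occurrences x a : ℕ) : ℝ) :=
        mod_cast hσ
    _ ≤ ∑ _a : X, 2 * c := by
        refine Finset.sum_le_sum fun a _ => ?_
        have hza := abs_le.1 (hz a)
        have hxa := abs_le.1 (hx a)
        rcases le_total (occurrences z a) (occurrences x a) with h | h
        · rw [Nat.sub_eq_zero_of_le h]; push_cast; linarith
        · rw [Nat.cast_sub h]; linarith
    _ = Fintype.card X * (2 * c) := by simp

lemma IsTypical.card_perm_le {x z : Fin n → X} (hx : IsTypical w c x) (hz : IsTypical w c z)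
    (E : Finset (Fin n → X)) :
    Finset.card {π : Equiv.Perm (Fin n) | z ∘ π ∈ E} ≤
      Finset.card {π : Equiv.Perm (Fin n) |
        ∃ e ∈ E, (hammingDist (x ∘ π) e : ℝ) ≤ Fintype.card X * (2 * c)} := by
  obtain ⟨σ, hσ⟩ := hx.exists_perm_hammingDist_le hz
  refine Finset.card_le_card_of_injOn (σ * ·) (fun π hπ => ?_) (mul_right_injective σ).injOn
  refine (Finset.mem_filter_univ _).2 ⟨z ∘ π, (Finset.mem_filter.1 hπ).2, ?_⟩
  rwa [Equiv.Perm.coe_mul, ← Function.comp_assoc, hammingDist_comp_equiv]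

end Typical

section Distortion

variable {X Y : Type*} {d : X → Y → ℝ≥0}

lemma exists_forall_le_nnreal [Finite X] [Finite Y] (d : X → Y → ℝ≥0) : ∃ L, ∀ a b, d a b ≤ L := by
  obtain ⟨L, hL⟩ := (Set.finite_range (Function.uncurry d)).bddAbove
  exact ⟨L, fun a b => hL ⟨(a, b), rfl⟩⟩

lemma exists_pos_forall_add_le_of_lt {ι : Type*} [Finite ι] (f g : ι → ℝ) :
    ∃ η : ℝ, 0 < η ∧ ∀ i, f i < g i → f i + η ≤ g i := by
  have hgap : ∀ᶠ η in 𝓝[>] (0 : ℝ), ∀ i, f i < g i → f i + η ≤ g i := by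
    refine eventually_all.2 fun i => eventually_imp_distrib_left.2 fun hi => ?_
    filter_upwards [Ioo_mem_nhdsGT (sub_pos.2 hi)] with η hη
    linarith [hη.2]
  exact ((eventually_mem_nhdsWithin (s := Set.Ioi (0 : ℝ))).and hgap).exists

variable {ι : Type*} [Fintype ι]

lemma sum_distortion_le_add_hammingDist_mul [DecidableEq X] {L : ℝ≥0} (hL : ∀ a b, d a b ≤ L)
    (x e : ι → X) (y : ι → Y) :
    ∑ k, (d (x k) (y k) : ℝ) ≤ ∑ k, (d (e k) (y k) : ℝ) + hammingDist x e * L := by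
  calc ∑ k, (d (x k) (y k) : ℝ)
      ≤ ∑ k, ((d (e k) (y k) : ℝ) + if x k ≠ e k then (L : ℝ) else 0) := by
        refine Finset.sum_le_sum fun k _ => ?_
        split_ifs with hk
        · exact (NNReal.coe_le_coe.2 (hL _ _)).trans (le_add_of_nonneg_left (d _ _).2)
        · rw [not_not.1 hk, add_zero]
    _ = ∑ k, (d (e k) (y k) : ℝ) + hammingDist x e * L := by
        rw [Finset.sum_add_distrib, ← Finset.sum_filter, Finset.sum_const, nsmul_eq_mul,
          hammingDist]

/- Where `z` has smaller distortion than `y`, moving a letter of `y` to that of `z` gains at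
least `η`. -/
lemma exists_hammingDist_le_and_sum_le [DecidableEq Y] {η : ℝ}
    (hη : ∀ a b b', d a b < d a b' → (d a b : ℝ) + η ≤ d a b') (x : ι → X) {y z : ι → Y} {B : ℝ}
    {t : ℕ} (hz : ∑ k, (d (x k) (z k) : ℝ) ≤ B) (hy : ∑ k, (d (x k) (y k) : ℝ) ≤ B + t * η) :
    ∃ y' : ι → Y, hammingDist y' y ≤ t ∧ ∑ k, (d (x k) (y' k) : ℝ) ≤ B := by
  classical
  let moved (T : Finset ι) : ι → Y := fun k => if k ∈ T then z k else y k
  have hmoved (T : Finset ι) : hammingDist (moved T) y ≤ T.card := by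
    refine Finset.card_le_card fun k hk => ?_
    by_contra hkT
    exact (Finset.mem_filter.1 hk).2 (if_neg hkT)
  set worse : Finset ι := {k | d (x k) (z k) < d (x k) (y k)} with hworse
  rcases le_total worse.card t with hcard | hcard
  · refine ⟨moved worse, (hmoved _).trans hcard, (Finset.sum_le_sum fun k _ => ?_).trans hz⟩
    by_cases hk : k ∈ worse
    · simp only [moved, if_pos hk, le_refl]
    · simp only [moved, if_neg hk, NNReal.coe_le_coe]
      simpa [hworse] using hk
  · obtain ⟨T, hT, rfl⟩ := Finset.exists_subset_card_eq hcard
    have hgain : ∑ k, ((d (x k) (moved T k) : ℝ) + if k ∈ T then η else 0) ≤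
        ∑ k, (d (x k) (y k) : ℝ) := by
      refine Finset.sum_le_sum fun k _ => ?_
      by_cases hk : k ∈ T
      · simp only [moved, if_pos hk]
        exact hη _ _ _ (Finset.mem_filter.1 (hT hk)).2
      · simp [moved, hk]
    rw [Finset.sum_add_distrib, Finset.sum_ite_mem, Finset.univ_inter, Finset.sum_const,
      nsmul_eq_mul] at hgain
    exact ⟨moved T, hmoved T, by linarith⟩

end Distortion

section PopularBlock

variable {X Y : Type*} [DecidableEq X] {w : X → ℝ} {d : X → Y → ℝ≥0} {m n : ℕ}
  {p p' B B' c c' : ℝ}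

/-- Some reproduction block `y` is popular: source blocks of total probability at least `p`, all of
them typical up to `c`, have (total, not average) distortion at most `B` to `y`. -/
def HasPopularBlock (w : X → ℝ) (d : X → Y → ℝ≥0) (n : ℕ) (p B c : ℝ) : Prop :=
  ∃ (E : Finset (Fin n → X)) (y : Fin n → Y), p ≤ ∑ x ∈ E, ∏ k, w (x k) ∧
    ∀ x ∈ E, ∑ k, (d (x k) (y k) : ℝ) ≤ B ∧ IsTypical w c x

lemma HasPopularBlock.mono (h : HasPopularBlock w d n p B c) (hp : p' ≤ p) (hB : B ≤ B')
    (hc : c ≤ c') : HasPopularBlock w d n p' B' c' := by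
  obtain ⟨E, y, hE, hx⟩ := h
  exact ⟨E, y, hp.trans hE, fun x hxE => ⟨(hx x hxE).1.trans hB, (hx x hxE).2.mono hc⟩⟩

lemma HasPopularBlock.distortion_nonneg (h : HasPopularBlock w d n p B c) (hp : 0 < p) :
    0 ≤ B := by
  obtain ⟨E, y, hE, hx⟩ := h
  obtain ⟨x, hxE⟩ : E.Nonempty := by
    rw [Finset.nonempty_iff_ne_empty]
    rintro rfl
    simp only [Finset.sum_empty] at hE
    exact hp.not_ge hE
  exact (Finset.sum_nonneg fun k _ => (d _ _).2).trans (hx x hxE).1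

lemma HasPopularBlock.append (hp : 0 ≤ p) (hp' : 0 ≤ p') (h : HasPopularBlock w d m p B c)
    (h' : HasPopularBlock w d n p' B' c') :
    HasPopularBlock w d (m + n) (p * p') (B + B') (c + c') := by
  obtain ⟨E, y, hE, hx⟩ := h
  obtain ⟨E', y', hE', hx'⟩ := h'
  refine ⟨(E ×ˢ E').map (Fin.appendEquiv m n).toEmbedding, Fin.append y y', ?_, ?_⟩
  · refine (mul_le_mul hE hE' hp' (hp.trans hE)).trans_eq ?_
    simp [Finset.sum_mul_sum, Finset.sum_product, Fin.prod_univ_add, Fin.appendEquiv]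
  · rintro _ hxm
    obtain ⟨⟨u, v⟩, huv, rfl⟩ := Finset.mem_map.1 hxm
    obtain ⟨hu, hv⟩ := Finset.mem_product.1 huv
    refine ⟨?_, (hx u hu).2.append (hx' v hv).2⟩
    simpa [Fin.sum_univ_add, Fin.appendEquiv] using add_le_add (hx u hu).1 (hx' v hv).1

variable [Fintype X] {L : ℝ≥0}

lemma hasPopularBlock_one [Nonempty Y] (hw : w ∈ stdSimplex ℝ X) (hL : ∀ a b, d a b ≤ L) (n : ℕ) :
    HasPopularBlock w d n 1 (n * L) n := by
  refine ⟨Finset.univ, fun _ => Classical.arbitrary Y, (prod_mem_stdSimplex hw).2.ge, fun x _ =>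
    ⟨(Finset.sum_le_sum fun k _ => NNReal.coe_le_coe.2 (hL _ _)).trans_eq ?_,
      isTypical_natCast hw x⟩⟩
  simp

lemma HasPopularBlock.replicate [Nonempty Y] (hw : w ∈ stdSimplex ℝ X) (hL : ∀ a b, d a b ≤ L)
    (hp : 0 ≤ p) (h : HasPopularBlock w d m p B c) (q : ℕ) :
    HasPopularBlock w d (q * m) (p ^ q) (q * B) (q * c) := by
  induction q with
  | zero => simpa using hasPopularBlock_one hw hL 0
  | succ q ih =>
    have := ih.append (pow_nonneg hp q) hp h
    rw [Nat.succ_mul, pow_succ]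
    push_cast
    convert this using 1 <;> ring

lemma HasPopularBlock.extend (hw : w ∈ stdSimplex ℝ X) (hL : ∀ a b, d a b ≤ L) (hm : 0 < m)
    {R D δ : ℝ} (hR : 0 ≤ R) (hδ : 0 ≤ δ)
    (h : HasPopularBlock w d m (2 ^ (-(m * R))) (m * D) (m * δ)) (n : ℕ) :
    HasPopularBlock w d n (2 ^ (-(n * R))) (n * D + m * L) (n * δ + m) := by
  have hm' : (0 : ℝ) < m := mod_cast hm
  have hD : 0 ≤ D := nonneg_of_mul_nonneg_right (h.distortion_nonneg (by positivity)) hm'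
  have : Nonempty Y := let ⟨_, y, _⟩ := h; ⟨y ⟨0, hm⟩⟩
  have hblock := (h.replicate hw hL (by positivity) (n / m)).append (by positivity) zero_le_one
    (hasPopularBlock_one hw hL (n % m))
  rw [Nat.div_add_mod'] at hblock
  have hrem : ((n % m : ℕ) : ℝ) ≤ m := mod_cast (n.mod_lt hm).le
  have hquot : ((n / m : ℕ) : ℝ) * m ≤ n := mod_cast Nat.div_mul_le_self n m
  refine hblock.mono ?_ ?_ ?_
  · rw [mul_one, ← Real.rpow_mul_natCast zero_le_two]
    refine Real.rpow_le_rpow_of_exponent_le one_le_two ?_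
    nlinarith
  · rw [← mul_assoc]
    gcongr
  · rw [← mul_assoc]
    gcongr

/- Among the rearrangements of a well chosen typical block `z`, a fraction `p` lies in the set
served by the popular block. A typical `x` is close to a rearrangement of `z`, hence a fraction `p`
of the rearrangements of the popular block serve `x`, and few of them serve all typical blocks. -/
lemma HasPopularBlock.exists_cover (hw : w ∈ stdSimplex ℝ X) (hL : ∀ a b, d a b ≤ L)
    (h : HasPopularBlock w d n p B c) (hp : 0 < p) (hp1 : p ≤ 1) {K : ℕ}
    (hK : (1 - p) ^ K * (Fintype.card X : ℝ) ^ n < 1) :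
    ∃ 𝒞 : Finset (Fin n → Y), 𝒞.card ≤ K ∧ ∀ x, IsTypical w c x →
      ∃ y ∈ 𝒞, ∑ k, (d (x k) (y k) : ℝ) ≤ B + Fintype.card X * (2 * c) * L := by
  classical
  obtain ⟨E, y, hE, hx⟩ := h
  obtain ⟨z, hz⟩ := exists_mul_card_perm_le hw E
  replace hz : p * Fintype.card (Equiv.Perm (Fin n)) ≤
      Finset.card {π : Equiv.Perm (Fin n) | z ∘ π ∈ E} := (by gcongr : _ ≤ _).trans hz
  have hzc : IsTypical w c z := by
    have hcard : (0 : ℝ) < Fintype.card (Equiv.Perm (Fin n)) := mod_cast Fintype.card_pos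
    obtain ⟨π, hπ⟩ := Finset.card_pos.1 (Nat.cast_pos.1 ((mul_pos hp hcard).trans_le hz))
    exact (isTypical_comp_perm_iff π).1 (hx _ (Finset.mem_filter.1 hπ).2).2
  let serves (x : Fin n → X) (π : Equiv.Perm (Fin n)) : Prop :=
    ∃ e ∈ E, (hammingDist (x ∘ π) e : ℝ) ≤ Fintype.card X * (2 * c)
  have hserves : ∀ x ∈ ({x | IsTypical w c x} : Finset (Fin n → X)),
      p * Fintype.card (Equiv.Perm (Fin n)) ≤ Finset.card {π | serves x π} := fun x hxc =>
    hz.trans <| mod_cast ((Finset.mem_filter_univ x).1 hxc).card_perm_le hzc E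
  have hcount : (Finset.card {x : Fin n → X | IsTypical w c x} : ℝ) ≤ Fintype.card X ^ n := by
    exact_mod_cast (Finset.card_le_univ _).trans_eq (by simp)
  obtain ⟨perms, hpermsK, hperms⟩ := exists_cover_of_pow_mul_card_lt_one serves _ hp1
      (by convert hserves) <|
    (mul_le_mul_of_nonneg_left hcount (pow_nonneg (sub_nonneg.2 hp1) K)).trans_lt hK
  refine ⟨perms.image fun π => y ∘ π.symm, Finset.card_image_le.trans hpermsK, fun x hxc => ?_⟩
  obtain ⟨π, hπ, e, he, hdist⟩ := hperms x ((Finset.mem_filter_univ x).2 hxc)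
  refine ⟨_, Finset.mem_image_of_mem _ hπ, ?_⟩
  calc ∑ k, (d (x k) ((y ∘ π.symm) k) : ℝ) = ∑ k, (d ((x ∘ π) k) (y k) : ℝ) := by
        rw [← Equiv.sum_comp π]; simp
    _ ≤ ∑ k, (d (e k) (y k) : ℝ) + hammingDist (x ∘ π) e * L :=
        sum_distortion_le_add_hammingDist_mul hL _ _ _
    _ ≤ B + Fintype.card X * (2 * c) * L := by
        gcongr
        exact (hx e he).1

lemma HasPopularBlock.exists_codebook [DecidableEq Y] [Fintype Y] (hw : w ∈ stdSimplex ℝ X)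
    (hL : ∀ a b, d a b ≤ L) {η : ℝ} (hη : ∀ a b b', d a b < d a b' → (d a b : ℝ) + η ≤ d a b')
    (h : HasPopularBlock w d n p B c) (hp : 0 < p) (hp1 : p ≤ 1) {K t : ℕ}
    (hK : (1 - p) ^ K * (Fintype.card X : ℝ) ^ n < 1)
    (ht : B + Fintype.card X * (2 * c) * L ≤ B' + t * η) {V : ℝ}
    (hV0 : 0 ≤ V)
    (hV : ∀ y : Fin n → Y, (Finset.card {y' : Fin n → Y | hammingDist y' y ≤ t} : ℝ) ≤ V) :
    ∃ 𝒞 : Finset (Fin n → Y), (𝒞.card : ℝ) ≤ K * V ∧ ∀ x, IsTypical w c x →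
      (∃ y : Fin n → Y, ∑ k, (d (x k) (y k) : ℝ) ≤ B') →
        ∃ y ∈ 𝒞, ∑ k, (d (x k) (y k) : ℝ) ≤ B' := by
  obtain ⟨𝒞, h𝒞K, h𝒞⟩ := h.exists_cover hw hL hp hp1 hK
  refine ⟨𝒞.biUnion fun y => {y' | hammingDist y' y ≤ t}, ?_, fun x hxc ⟨z, hz⟩ => ?_⟩
  · calc ((𝒞.biUnion fun y => {y' | hammingDist y' y ≤ t}).card : ℝ)
        ≤ ∑ y ∈ 𝒞, (Finset.card {y' : Fin n → Y | hammingDist y' y ≤ t} : ℝ) :=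
          mod_cast Finset.card_biUnion_le
      _ ≤ 𝒞.card * V := by
          rw [← nsmul_eq_mul]
          exact Finset.sum_le_card_nsmul _ _ _ fun y _ => hV y
      _ ≤ K * V := by gcongr
  · obtain ⟨y, hy, hxy⟩ := h𝒞 x hxc
    obtain ⟨y', hy'y, hxy'⟩ := exists_hammingDist_le_and_sum_le hη x hz (hxy.trans ht)
    exact ⟨y', Finset.mem_biUnion.2 ⟨y, hy, (Finset.mem_filter_univ _).2 hy'y⟩, hxy'⟩

end PopularBlock

section Codebook

lemma exists_pow_mul_pow_lt_one {p N : ℝ} (hp : 0 < p) (hp1 : p ≤ 1) (hN : 0 ≤ N) (n : ℕ) :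
    ∃ K : ℕ, (1 - p) ^ K * N ^ n < 1 ∧ (K : ℝ) ≤ (n * N + 1) * p⁻¹ := by
  refine ⟨⌊n * N * p⁻¹⌋₊ + 1, ?_, ?_⟩
  · set K := ⌊n * N * p⁻¹⌋₊ + 1 with hK
    have hKlt : n * N < p * K := by
      rw [← div_lt_iff₀' hp, div_eq_mul_inv, hK, Nat.cast_add_one]
      exact Nat.lt_floor_add_one _
    have hcompl : (1 - p) ^ K ≤ Real.exp (-(p * K)) := by
      rw [← neg_mul, mul_comm, Real.exp_nat_mul]
      exact pow_le_pow_left₀ (sub_nonneg.2 hp1) (Real.one_sub_le_exp_neg p) K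
    have hcard : N ^ n ≤ Real.exp (n * N) := by
      rw [Real.exp_nat_mul]
      exact pow_le_pow_left₀ hN ((le_add_of_nonneg_right zero_le_one).trans
        (Real.add_one_le_exp N)) n
    calc (1 - p) ^ K * N ^ n ≤ Real.exp (-(p * K)) * Real.exp (n * N) := by gcongr
      _ = Real.exp (n * N - p * K) := by rw [← Real.exp_add]; ring_nf
      _ < 1 := Real.exp_lt_one_iff.2 (sub_neg.2 hKlt)
  · have hfloor : (⌊n * N * p⁻¹⌋₊ : ℝ) ≤ n * N * p⁻¹ := Nat.floor_le (by positivity)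
    have hinv : 1 ≤ p⁻¹ := (one_le_inv₀ hp).2 hp1
    push_cast
    linarith

lemma eventually_mul_add_one_le_rpow (N : ℝ) {b : ℝ} (hb : 1 < b) :
    ∀ᶠ n : ℕ in atTop, n * N + 1 ≤ b ^ n := by
  have hlim := ((tendsto_pow_const_div_const_pow_of_one_lt 1 hb).mul_const N).add
    (tendsto_pow_const_div_const_pow_of_one_lt 0 hb)
  rw [zero_mul, add_zero] at hlim
  filter_upwards [hlim.eventually_le_const one_pos] with n hn
  rwa [pow_one, pow_zero, div_mul_eq_mul_div, ← add_div, div_le_one (by positivity)] at hn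

lemma eventually_add_mul_le_mul {a b : ℝ} (c : ℝ) (hab : a < b) :
    ∀ᶠ n : ℕ in atTop, c + a * n ≤ b * n := by
  filter_upwards [tendsto_natCast_atTop_atTop.eventually_ge_atTop (c / (b - a))] with n hn
  rw [div_le_iff₀' (sub_pos.2 hab)] at hn
  linarith

lemma exists_natCast_mul_mem_Icc {e η : ℝ} (he : 0 ≤ e) (hη : 0 < η) :
    ∃ t : ℕ, t * η ∈ Set.Icc e (e + η) := by
  refine ⟨⌈e / η⌉₊, (div_le_iff₀ hη).1 (Nat.le_ceil _), ?_⟩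
  rw [← le_div_iff₀ hη, ← div_add_one hη.ne']
  exact (Nat.ceil_lt_add_one (by positivity)).le

variable {X Y : Type*} [DecidableEq X] [Fintype X] [Finite Y]

/- Repeating a popular block costs nothing asymptotically, and the distortion in excess of `n * D`
which the covering leaves is removed by passing to small Hamming balls. -/
lemma exists_codebook_of_hasPopularBlock {w : X → ℝ} (hw : w ∈ stdSimplex ℝ X)
    (d : X → Y → ℝ≥0) {R R₁ : ℝ} (hR : 0 ≤ R) (hRR : R < R₁) :
    ∃ δ : ℝ, 0 < δ ∧ ∀ (D : ℝ) (m : ℕ), 0 < m →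
      HasPopularBlock w d m (2 ^ (-(m * R))) (m * D) (m * δ) →
      ∀ᶠ n : ℕ in atTop, ∃ 𝒞 : Finset (Fin n → Y), (𝒞.card : ℝ) ≤ 2 ^ (n * R₁) ∧
        ∀ x : Fin n → X, IsTypical w (n * δ) x →
          (∃ y : Fin n → Y, ∑ k, (d (x k) (y k) : ℝ) ≤ n * D) →
          ∃ y ∈ 𝒞, ∑ k, (d (x k) (y k) : ℝ) ≤ n * D := by
  classical
  cases nonempty_fintype Y
  obtain ⟨L, hL⟩ := exists_forall_le_nnreal d
  obtain ⟨η, hη0, hη⟩ := exists_pos_forall_add_le_of_lt (ι := X × Y × Y)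
    (fun i => d i.1 i.2.1) (fun i => d i.1 i.2.2)
  set N : ℕ := Fintype.card X
  set b : ℝ := 2 ^ ((R₁ - R) / 2) with hb
  have hb1 : 1 < b := Real.one_lt_rpow one_lt_two (by linarith)
  obtain ⟨τ, hτ0, hτ⟩ := exists_card_hammingDist_le_pow Y hb1
  obtain ⟨δ, hδ0, hδ⟩ := exists_pos_mul_lt (mul_pos hτ0 hη0) (N * 4 * L : ℝ)
  refine ⟨δ, hδ0, fun D m hm hpop => ?_⟩
  filter_upwards [eventually_mul_add_one_le_rpow N hb1, eventually_add_mul_le_mul m hδ0,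
    eventually_add_mul_le_mul (m * L + η) hδ] with n hn hnm hnt
  have hp0 : (0 : ℝ) < 2 ^ (-(n * R)) := by positivity
  have hp1 : (2 : ℝ) ^ (-(n * R)) ≤ 1 :=
    Real.rpow_le_one_of_one_le_of_nonpos one_le_two (neg_nonpos.2 (by positivity))
  obtain ⟨K, hK, hKle⟩ := exists_pow_mul_pow_lt_one hp0 hp1 N.cast_nonneg n
  have hpop' : HasPopularBlock w d n (2 ^ (-(n * R))) (n * D + m * L) (2 * (n * δ)) :=
    (hpop.extend hw hL hm hR hδ0.le n).mono le_rfl le_rfl (by linarith)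
  obtain ⟨t, het, hte⟩ :=
    exists_natCast_mul_mem_Icc (e := m * L + N * (2 * (2 * (n * δ))) * L) (by positivity) hη0
  have htn : (t : ℝ) ≤ τ * n := by
    refine le_of_mul_le_mul_right ?_ hη0
    calc t * η ≤ m * L + N * (2 * (2 * (n * δ))) * L + η := hte
      _ = m * L + η + N * 4 * L * δ * n := by ring
      _ ≤ τ * η * n := hnt
      _ = τ * n * η := by ring
  have ht : n * D + m * L + N * (2 * (2 * (n * δ))) * L ≤ n * D + t * η := by linarith
  obtain ⟨𝒞, h𝒞K, h𝒞⟩ := hpop'.exists_codebook hw hL (fun a b b' => hη (a, b, b')) hp0 hp1 hK ht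
    (by positivity) fun y => hτ n y _ htn
  refine ⟨𝒞, h𝒞K.trans ?_, fun x hx => h𝒞 x
    (hx.mono (by linarith [mul_nonneg (n.cast_nonneg (α := ℝ)) hδ0.le]))⟩
  calc (K : ℝ) * b ^ n ≤ b ^ n * (2 ^ (-(n * R)))⁻¹ * b ^ n := by
        gcongr
        exact hKle.trans (by gcongr)
    _ = 2 ^ (n * R₁) := by
        rw [hb, ← Real.rpow_mul_natCast zero_le_two, ← Real.rpow_neg zero_le_two,
          ← Real.rpow_add two_pos, ← Real.rpow_add two_pos]
        ring_nf

end Codebook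

/-! ### Below the rate-distortion function no reproduction block is popular -/

section Typicality

variable {X : Type*} (n : ℕ) (a : X)

lemma natCast_occurrences_eq_sum_indicator [DecidableEq X] :
    (fun x : Fin n → X => (occurrences x a : ℝ)) =
      ∑ k, fun x => ({a} : Set X).indicator (1 : X → ℝ) (x k) := by
  ext x
  simp only [occurrences, Finset.card_filter, Finset.sum_apply, Set.indicator,
    Set.mem_singleton_iff, Pi.one_apply]
  push_cast
  rfl

variable [MeasurableSpace X] [MeasurableSingletonClass X] (μ : Measure X) [IsProbabilityMeasure μ]

lemma memLp_indicator_singleton : MemLp (({a} : Set X).indicator (1 : X → ℝ)) 2 μ :=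
  (memLp_const (1 : ℝ)).indicator (measurableSet_singleton a)

lemma memLp_indicator_singleton_eval (k : Fin n) :
    MemLp (fun x : Fin n → X => ({a} : Set X).indicator (1 : X → ℝ) (x k)) 2
      (Measure.pi fun _ => μ) :=
  (memLp_indicator_singleton a μ).comp_measurePreserving (measurePreserving_eval _ k)

variable [DecidableEq X]

lemma memLp_natCast_occurrences :
    MemLp (fun x : Fin n → X => (occurrences x a : ℝ)) 2 (Measure.pi fun _ => μ) := by
  rw [natCast_occurrences_eq_sum_indicator]
  exact memLp_finsetSum' _ fun k _ => memLp_indicator_singleton_eval n a μ k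

lemma integral_natCast_occurrences :
    ∫ x : Fin n → X, (occurrences x a : ℝ) ∂(Measure.pi fun _ => μ) = n * μ.real {a} := by
  have hletter (k : Fin n) : ∫ x : Fin n → X, ({a} : Set X).indicator (1 : X → ℝ) (x k)
      ∂(Measure.pi fun _ => μ) = μ.real {a} := by
    rw [integral_comp_eval (memLp_indicator_singleton a μ).aestronglyMeasurable,
      integral_indicator_one (measurableSet_singleton a)]
  have hsum (x : Fin n → X) := congrFun (natCast_occurrences_eq_sum_indicator n a) x
  simp only [Finset.sum_apply] at hsum
  simp_rw [hsum]
  rw [integral_finsetSum _ fun k _ =>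
    (memLp_indicator_singleton_eval n a μ k).integrable one_le_two]
  simp only [hletter, Finset.sum_const, Finset.card_univ, Fintype.card_fin, nsmul_eq_mul]

lemma variance_natCast_occurrences_le :
    Var[fun x : Fin n → X => (occurrences x a : ℝ); Measure.pi fun _ => μ] ≤ n := by
  have hletter : Var[({a} : Set X).indicator (1 : X → ℝ); μ] ≤ 1 := by
    have hmem (x : X) : ({a} : Set X).indicator (1 : X → ℝ) x ∈ Set.Icc 0 1 := by
      by_cases hx : x = a <;> simp [Set.indicator, hx]
    have := variance_le_sq_of_bounded (μ := μ) (Eventually.of_forall hmem)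
      (memLp_indicator_singleton a μ).aestronglyMeasurable.aemeasurable
    linarith
  rw [natCast_occurrences_eq_sum_indicator, variance_sum_pi fun _ => memLp_indicator_singleton a μ]
  exact (Finset.sum_le_card_nsmul _ _ 1 fun _ _ => hletter).trans_eq (by simp)

variable {μ n a} {δ : ℝ}

lemma measure_le_abs_occurrences_sub_le (hδ : 0 < δ) (hn : 0 < n) :
    (Measure.pi fun _ : Fin n => μ) {x | n * δ ≤ |(occurrences x a : ℝ) - n * μ.real {a}|} ≤
      ENNReal.ofReal (1 / δ ^ 2 / n) := by
  have hn' : (0 : ℝ) < n := mod_cast hn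
  have hchebyshev := meas_ge_le_variance_div_sq (memLp_natCast_occurrences n a μ) (mul_pos hn' hδ)
  rw [integral_natCast_occurrences] at hchebyshev
  refine hchebyshev.trans (ENNReal.ofReal_le_ofReal ?_)
  calc _ ≤ (n : ℝ) / (n * δ) ^ 2 := by gcongr; exact variance_natCast_occurrences_le n a μ
    _ = 1 / δ ^ 2 / n := by field_simp

variable (μ) in
lemma tendsto_measure_compl_isTypical [Finite X] (hδ : 0 < δ) :
    Tendsto (fun n => (Measure.pi fun _ : Fin n => μ)
      {x | IsTypical (fun a => μ.real {a}) (n * δ) x}ᶜ) atTop (𝓝 0) := by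
  cases nonempty_fintype X
  have hlim : Tendsto (fun n : ℕ => ∑ _a : X, ENNReal.ofReal (1 / δ ^ 2 / n)) atTop (𝓝 0) := by
    have hletter := ENNReal.tendsto_ofReal (tendsto_const_div_atTop_nhds_zero_nat (1 / δ ^ 2))
    rw [ENNReal.ofReal_zero] at hletter
    simpa using tendsto_finsetSum (Finset.univ : Finset X) fun _ _ => hletter
  refine tendsto_of_tendsto_of_tendsto_of_le_of_le' tendsto_const_nhds hlim
    (Eventually.of_forall fun _ => zero_le) ?_
  filter_upwards [eventually_gt_atTop 0] with n hn
  refine (measure_mono fun x hx => ?_).trans <| (measure_iUnion_fintype_le _ fun a =>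
    {x : Fin n → X | n * δ ≤ |(occurrences x a : ℝ) - n * μ.real {a}|}).trans <|
      Finset.sum_le_sum fun a _ => measure_le_abs_occurrences_sub_le hδ hn
  simp only [Set.mem_compl_iff, Set.mem_ofPred_eq, IsTypical, not_forall, not_le] at hx
  exact Set.mem_iUnion.2 (hx.imp fun _ => le_of_lt)

end Typicality

section Achievability

variable {X Y : Type} {d : X → Y → ℝ≥0} {D : ℝ} {R R' : ℝ≥0} {n : ℕ}

lemma msgCount_pos (R : ℝ≥0) (n : ℕ) : 0 < msgCount R n :=
  Nat.floor_pos.2 (Real.one_le_rpow one_le_two (by positivity))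

instance : NeZero (msgCount R n) := ⟨(msgCount_pos R n).ne'⟩

lemma natCast_msgCount_le (R : ℝ≥0) (n : ℕ) :
    (msgCount R n : ℝ≥0∞) ≤ ENNReal.ofReal (2 ^ (n * R : ℝ)) := by
  rw [← ENNReal.ofReal_natCast]
  exact ENNReal.ofReal_le_ofReal (Nat.floor_le (by positivity))

lemma msgCount_mono (h : R ≤ R') (n : ℕ) : msgCount R n ≤ msgCount R' n :=
  Nat.floor_mono (Real.rpow_le_rpow_of_exponent_le one_le_two (by gcongr))

lemma avgDistortion_le_iff (hn : 0 < n) (x : Fin n → X) (y : Fin n → Y) :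
    avgDistortion d x y ≤ D ↔ ∑ k, (d (x k) (y k) : ℝ) ≤ n * D := by
  rw [avgDistortion, div_le_iff₀' (mod_cast hn)]

lemma exists_code_of_cover {α β : Type*} [Nonempty β] {r : α → β → Prop} {S : Set α}
    {𝒞 : Finset β} {M : ℕ} (hM : 0 < M) (hcard : 𝒞.card ≤ M) (hcover : ∀ a ∈ S, ∃ b ∈ 𝒞, r a b) :
    ∃ (enc : α → Fin M) (dec : Fin M → β), ∀ a ∈ S, r a (dec (enc a)) := by
  have : Nonempty (Fin M) := ⟨⟨0, hM⟩⟩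
  obtain ⟨f⟩ : Nonempty (𝒞 ↪ Fin M) :=
    Function.Embedding.nonempty_of_card_le (by simpa using hcard)
  let dec : Fin M → β := Function.extend f Subtype.val fun _ => Classical.arbitrary β
  have hmsg : ∀ a ∈ S, ∃ m, r a (dec m) := fun a ha =>
    let ⟨b, hb, hab⟩ := hcover a ha
    ⟨f ⟨b, hb⟩, by simpa only [dec, f.injective.extend_apply] using hab⟩
  choose! enc henc using hmsg
  exact ⟨enc, dec, henc⟩

variable [MeasurableSpace X] {μ : Measure X}

lemma IsAchievableRate.mono (h : IsAchievableRate μ d D R) (hR : R ≤ R') :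
    IsAchievableRate μ d D R' := by
  obtain ⟨enc, dec, h⟩ := h
  refine ⟨fun n x => Fin.castLE (msgCount_mono hR n) (enc n x), fun n m =>
    if hm : m.1 < msgCount R n then dec n ⟨m.1, hm⟩ else dec n ⟨0, msgCount_pos R n⟩, ?_⟩
  simpa [CompressesWithin] using h

lemma isAchievableRate_of_rateDistortion_lt (h : rateDistortion μ d D < R) :
    IsAchievableRate μ d D R := by
  simp only [rateDistortion, iInf_lt_iff] at h
  obtain ⟨R', hR', hlt⟩ := h
  exact hR'.mono (mod_cast hlt.le)

lemma not_isAchievableRate_of_lt_rateDistortion (h : R < rateDistortion μ d D) :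
    ¬ IsAchievableRate μ d D R := fun hR =>
  h.not_ge (iInf₂_le R hR)

lemma isAchievableRate_of_codebooks [Nonempty Y] {S : ∀ n, Set (Fin n → X)}
    (hS : Tendsto (fun n => (Measure.pi fun _ : Fin n => μ) (S n)ᶜ) atTop (𝓝 0))
    (h : ∀ᶠ n : ℕ in atTop, ∃ 𝒞 : Finset (Fin n → Y), (𝒞.card : ℝ) ≤ 2 ^ (n * R : ℝ) ∧
      ∀ x ∈ S n, ∃ y ∈ 𝒞, avgDistortion d x y ≤ D) : IsAchievableRate μ d D R := by
  have hcode : ∀ n, ∃ c : ((Fin n → X) → Fin (msgCount R n)) × (Fin (msgCount R n) → Fin n → Y),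
      (∃ 𝒞 : Finset (Fin n → Y), (𝒞.card : ℝ) ≤ 2 ^ (n * R : ℝ) ∧
        ∀ x ∈ S n, ∃ y ∈ 𝒞, avgDistortion d x y ≤ D) →
      ∀ x ∈ S n, avgDistortion d x (c.2 (c.1 x)) ≤ D := fun n => by
    by_cases hex : ∃ 𝒞 : Finset (Fin n → Y), (𝒞.card : ℝ) ≤ 2 ^ (n * R : ℝ) ∧
        ∀ x ∈ S n, ∃ y ∈ 𝒞, avgDistortion d x y ≤ D
    · obtain ⟨𝒞, hcard, hcover⟩ := hex
      obtain ⟨enc, dec, hcode⟩ :=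
        exists_code_of_cover (msgCount_pos R n) (Nat.le_floor hcard) hcover
      exact ⟨(enc, dec), fun _ => hcode⟩
    · exact ⟨(fun _ => ⟨0, msgCount_pos R n⟩, fun _ => Classical.arbitrary _),
        fun h => absurd h hex⟩
  choose c hc using hcode
  refine ⟨fun n => (c n).1, fun n => (c n).2, tendsto_of_tendsto_of_tendsto_of_le_of_le'
    tendsto_const_nhds hS (Eventually.of_forall fun _ => zero_le) ?_⟩
  filter_upwards [h] with n hn
  exact measure_mono fun x hx hxS => (hc n hn x hxS).not_gt hx

end Achievability

section Packing

variable {X Y : Type} [MeasurableSpace X]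

/-- With probability tending to one, a source block of length `n` has some reproduction block within
average distortion `D`: what remains of communicating the source when rates are disregarded. -/
def IsReproducible (μ : Measure X) (d : X → Y → ℝ≥0) (D : ℝ) : Prop :=
  Tendsto (fun n : ℕ => (Measure.pi fun _ : Fin n => μ)
    {x | ∀ y : Fin n → Y, D < avgDistortion d x y}) atTop (𝓝 0)

variable {μ : Measure X} [IsProbabilityMeasure μ] {d : X → Y → ℝ≥0} {D : ℝ}

lemma IsReproducible.nonempty (h : IsReproducible μ d D) : Nonempty Y := by
  by_contra hY
  rw [not_nonempty_iff] at hY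
  refine one_ne_zero (tendsto_nhds_unique (tendsto_const_nhds.congr' ?_) h)
  filter_upwards [eventually_gt_atTop 0] with n hn
  have : IsEmpty (Fin n → Y) := ⟨fun y => hY.elim (y ⟨0, hn⟩)⟩
  simp

variable (μ) in
lemma measureReal_singleton_mem_stdSimplex [Fintype X] [MeasurableSingletonClass X] :
    (fun a => μ.real {a}) ∈ stdSimplex ℝ X :=
  ⟨fun _ => measureReal_nonneg, by simp⟩

variable (μ) in
lemma measure_pi_coe_finset [MeasurableSingletonClass X] {n : ℕ}
    (E : Finset (Fin n → X)) :
    (Measure.pi fun _ : Fin n => μ) E = ENNReal.ofReal (∑ x ∈ E, ∏ k, μ.real {x k}) := by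
  rw [← sum_measure_singleton, ENNReal.ofReal_sum_of_nonneg fun x _ =>
    Finset.prod_nonneg fun k _ => measureReal_nonneg]
  refine Finset.sum_congr rfl fun x _ => ?_
  rw [Measure.pi_singleton, ENNReal.ofReal_prod_of_nonneg fun k _ => measureReal_nonneg]
  simp

variable [MeasurableSingletonClass X] [Finite X] [Finite Y]

variable (μ d) in
lemma exists_isAchievableRate_of_hasPopularBlock [DecidableEq X] {R R₁ : ℝ≥0} (hR : R < R₁) :
    ∃ δ : ℝ, 0 < δ ∧ ∀ (D : ℝ) (m : ℕ), 0 < m →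
      HasPopularBlock (fun a => μ.real {a}) d m (2 ^ (-(m * R : ℝ))) (m * D) (m * δ) →
      IsReproducible μ d D → IsAchievableRate μ d D R₁ := by
  cases nonempty_fintype X
  obtain ⟨δ, hδ, hcode⟩ :=
    exists_codebook_of_hasPopularBlock (measureReal_singleton_mem_stdSimplex μ) d R.coe_nonneg
      (NNReal.coe_lt_coe.2 hR)
  refine ⟨δ, hδ, fun D m hm hpop hrep => ?_⟩
  have := hrep.nonempty
  refine isAchievableRate_of_codebooks (S := fun n =>
    {x | IsTypical (fun a => μ.real {a}) (n * δ) x} ∩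
      {x | ∃ y : Fin n → Y, avgDistortion d x y ≤ D}) ?_ ?_
  · have hsum := (tendsto_measure_compl_isTypical μ hδ).add hrep
    rw [add_zero] at hsum
    refine tendsto_of_tendsto_of_tendsto_of_le_of_le tendsto_const_nhds hsum
      (fun _ => zero_le) fun n => (measure_mono fun x hx => ?_).trans (measure_union_le _ _)
    simpa [Set.compl_inter, not_or] using hx
  · filter_upwards [hcode D m hm hpop, eventually_gt_atTop 0] with n hn hn0
    simpa only [avgDistortion_le_iff hn0, Set.mem_inter_iff, Set.mem_ofPred_eq, and_imp] using hn

lemma exists_measure_isTypical_inter_le [DecidableEq X] {R : ℝ≥0} (hR : R < rateDistortion μ d D) :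
    ∃ δ : ℝ, 0 < δ ∧ (IsReproducible μ d D → ∀ n : ℕ, 0 < n → ∀ y : Fin n → Y,
      (Measure.pi fun _ : Fin n => μ) ({x | IsTypical (fun a => μ.real {a}) (n * δ) x} ∩
        {x | avgDistortion d x y ≤ D}) ≤ ENNReal.ofReal (2 ^ (-(n * R : ℝ)))) := by
  cases nonempty_fintype X
  obtain ⟨R₁, hRR₁, hR₁⟩ := ENNReal.lt_iff_exists_nnreal_btwn.1 hR
  obtain ⟨δ, hδ, hach⟩ :=
    exists_isAchievableRate_of_hasPopularBlock μ d (ENNReal.coe_lt_coe.1 hRR₁)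
  refine ⟨δ, hδ, fun hrep n hn y => ?_⟩
  by_contra! hlarge
  refine not_isAchievableRate_of_lt_rateDistortion hR₁ (hach D n hn ?_ hrep)
  classical
  set B : Set (Fin n → X) := {x | IsTypical (fun a => μ.real {a}) (n * δ) x} ∩
    {x | avgDistortion d x y ≤ D}
  refine ⟨B.toFinset, y, ?_, fun x hx => ?_⟩
  · rw [← Set.coe_toFinset B, measure_pi_coe_finset,
      ENNReal.ofReal_lt_ofReal_iff_of_nonneg (by positivity)] at hlarge
    exact hlarge.le
  · obtain ⟨htyp, hdist⟩ := Set.mem_toFinset.1 hx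
    exact ⟨(avgDistortion_le_iff hn x y).1 hdist, htyp⟩

lemma exists_packing {R : ℝ≥0} (hR : R < rateDistortion μ d D) :
    ∃ T : ∀ n, Set (Fin n → X),
      Tendsto (fun n => (Measure.pi fun _ : Fin n => μ) (T n)ᶜ) atTop (𝓝 0) ∧
      (IsReproducible μ d D → Tendsto (fun n => (msgCount R n : ℝ≥0∞) *
        ⨆ y, (Measure.pi fun _ : Fin n => μ) (T n ∩ {x | avgDistortion d x y ≤ D}))
        atTop (𝓝 0)) := by
  classical
  obtain ⟨R', hRR', hR'⟩ := ENNReal.lt_iff_exists_nnreal_btwn.1 hR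
  obtain ⟨δ, hδ, hball⟩ := exists_measure_isTypical_inter_le hR'
  refine ⟨_, tendsto_measure_compl_isTypical μ hδ, fun hrep => ?_⟩
  have hlim : Tendsto (fun n : ℕ => ENNReal.ofReal ((2 ^ (R - R' : ℝ)) ^ n)) atTop (𝓝 0) := by
    have hpow : (2 : ℝ) ^ (R - R' : ℝ) < 1 := Real.rpow_lt_one_of_one_lt_of_neg one_lt_two
      (sub_neg.2 (NNReal.coe_lt_coe.2 (ENNReal.coe_lt_coe.1 hRR')))
    simpa using ENNReal.tendsto_ofReal
      (tendsto_pow_atTop_nhds_zero_of_lt_one (by positivity) hpow)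
  refine tendsto_of_tendsto_of_tendsto_of_le_of_le' tendsto_const_nhds hlim
    (Eventually.of_forall fun _ => zero_le) ?_
  filter_upwards [eventually_gt_atTop 0] with n hn
  calc _ ≤ ENNReal.ofReal (2 ^ (n * R : ℝ)) * ENNReal.ofReal (2 ^ (-(n * R' : ℝ))) :=
        mul_le_mul' (natCast_msgCount_le R n) (iSup_le (hball hrep n hn))
    _ = ENNReal.ofReal ((2 ^ (R - R' : ℝ)) ^ n) := by
        rw [← ENNReal.ofReal_mul (by positivity), ← Real.rpow_add two_pos,
          ← Real.rpow_mul_natCast zero_le_two]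
        ring_nf

end Packing

/-! ### Random codebooks -/

section Reindex

variable {ι κ : Type*} [Fintype ι] [Fintype κ] {X : κ → Type*} [∀ k, MeasurableSpace (X k)]
  (μ : ∀ k, Measure (X k)) [∀ k, IsProbabilityMeasure (μ k)] {e : ι → κ}

lemma measurePreserving_pi_precomp (he : e.Injective) :
    MeasurePreserving (fun (c : ∀ k, X k) i => c (e i)) (Measure.pi μ)
      (Measure.pi fun i => μ (e i)) := by
  refine ⟨by fun_prop, ?_⟩
  have hindep := (iIndepFun_pi (X := fun k (x : X k) => x) (μ := μ)
    fun _ => aemeasurable_id).precomp he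
  rw [(iIndepFun_iff_map_fun_eq_pi_map fun i =>
    (measurable_pi_apply (e i)).aemeasurable).1 hindep]
  exact congrArg Measure.pi (funext fun i => (measurePreserving_eval μ (e i)).map_eq)

lemma measurePreserving_pi_eval_prodMk_precomp (he : e.Injective) {k : κ} (hk : ∀ i, e i ≠ k) :
    MeasurePreserving (fun c : ∀ k, X k => (c k, fun i => c (e i))) (Measure.pi μ)
      ((μ k).prod (Measure.pi fun i => μ (e i))) := by
  have hinj : (Sum.elim (fun _ : Unit => k) e).Injective :=
    (Function.injective_of_subsingleton _).sumElim he fun _ i => (hk i).symm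
  exact ((measurePreserving_eval (fun _ : Unit => μ k) ()).prod (.id _)).comp <|
    (measurePreserving_sumPiEquivProdPi fun i => μ (Sum.elim (fun _ : Unit => k) e i)).comp <|
      measurePreserving_pi_precomp μ hinj

end Reindex

section Codebook

variable {A : Type} {In : A → Type} {M : A → ℕ}

/-- A choice of codewords, one for every message `m : Fin (M p)` of every `p`. -/
abbrev Codebook (M : A → ℕ) (In : A → Type) := ∀ s : Σ p, Fin (M p), In s.1

/-- The codeword for the message `m` of `p`. -/
abbrev Codebook.codeword (c : Codebook M In) (p : A) (m : Fin (M p)) : In p := c ⟨p, m⟩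

/-- The codewords which represent the messages `msg`. -/
def Codebook.encode (c : Codebook M In) (msg : ∀ p, Fin (M p)) (p : A) : In p :=
  c.codeword p (msg p)

variable [∀ p, MeasurableSpace (In p)]

lemma measurable_codeword (p : A) :
    Measurable fun w : Fin (M p) × Codebook M In => w.2.codeword p w.1 :=
  measurable_from_prod_countable_right fun m => measurable_pi_apply (⟨p, m⟩ : Σ p, Fin (M p))

lemma measurable_codewords {ι : Type*} (e : ι → A) :
    Measurable fun (w : (∀ i, Fin (M (e i))) × Codebook M In) i =>
      w.2.codeword (e i) (w.1 i) := by
  refine measurable_pi_lambda _ fun i => ?_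
  have hi : Measurable fun w : (∀ i, Fin (M (e i))) × Codebook M In => (w.1 i, w.2) := by fun_prop
  exact (measurable_codeword (e i)).comp hi

lemma measurable_encode :
    Measurable fun w : (∀ p, Fin (M p)) × Codebook M In => w.2.encode w.1 :=
  measurable_codewords id

variable [Fintype A]

/-- The law of a codebook of independent codewords, those of `p` with law `ζ p`. -/
noncomputable def codebookLaw (M : A → ℕ) (ζ : ∀ p, Measure (In p)) : Measure (Codebook M In) :=
  Measure.pi fun s => ζ s.1

variable (ζ : ∀ p, Measure (In p)) [∀ p, IsProbabilityMeasure (ζ p)]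

instance : IsProbabilityMeasure (codebookLaw M ζ) :=
  inferInstanceAs (IsProbabilityMeasure (Measure.pi _))

lemma map_codebookLaw_encode (msg : ∀ p, Fin (M p)) :
    (codebookLaw M ζ).map (·.encode msg) = Measure.pi ζ :=
  (measurePreserving_pi_precomp _ (e := fun p => (⟨p, msg p⟩ : Σ p, Fin (M p)))
    fun _ _ h => congrArg Sigma.fst h).map_eq

lemma map_codebookLaw_prodMk_encode (msg : ∀ p, Fin (M p)) {p : A} {m : Fin (M p)}
    (hm : m ≠ msg p) :
    (codebookLaw M ζ).map (fun c => (c.codeword p m, c.encode msg)) =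
      (ζ p).prod (Measure.pi ζ) := by
  refine (measurePreserving_pi_eval_prodMk_precomp _
    (e := fun p => (⟨p, msg p⟩ : Σ p, Fin (M p))) (fun _ _ h => congrArg Sigma.fst h) ?_).map_eq
  rintro q h
  obtain rfl : q = p := congrArg Sigma.fst h
  exact hm (eq_of_heq (Sigma.mk.inj h).2).symm

lemma measurePreserving_encode (b : Measure (∀ p, Fin (M p))) [IsProbabilityMeasure b] :
    MeasurePreserving (fun w => w.2.encode w.1) (b.prod (codebookLaw M ζ)) (Measure.pi ζ) :=
  measurePreserving_of_ae_map_eq b _ measurable_encode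
    (ae_of_all _ fun msg => map_codebookLaw_encode ζ msg)

lemma measurePreserving_prodMk_encode {msg : ∀ p, Fin (M p)} {p : A} {m : Fin (M p)}
    (hm : m ≠ msg p) :
    MeasurePreserving (fun w => (w.2.codeword p m, w.2.encode w.1))
      ((Measure.dirac msg).prod (codebookLaw M ζ)) ((ζ p).prod (Measure.pi ζ)) := by
  refine measurePreserving_of_ae_map_eq _ _ (Measurable.prodMk (by fun_prop) measurable_encode) ?_
  rw [ae_dirac_eq]
  exact map_codebookLaw_prodMk_encode ζ msg hm

end Codebook

/-! ### Random coding over a network -/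

section MatchDecoder

variable {α γ : Type*} {M : ℕ} [NeZero M] {W : Set (α × γ)}

/-- Decodes the output `y` to a message whose codeword matches it in the sense of `W`; an arbitrary
message if there is none. -/
noncomputable def matchDecoder (W : Set (α × γ)) (z : γ × (Fin M → α)) : Fin M :=
  Classical.epsilon fun m => (z.2 m, z.1) ∈ W

lemma matchDecoder_eq {y : γ} {c : Fin M → α} {m : Fin M} (hm : (c m, y) ∈ W)
    (huniq : ∀ m' ≠ m, (c m', y) ∉ W) : matchDecoder W (y, c) = m :=
  of_not_not fun hne => huniq _ hne (Classical.epsilon_spec (p := fun m => (c m, y) ∈ W) ⟨m, hm⟩)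

lemma measurable_matchDecoder [MeasurableSpace α] [MeasurableSpace γ] (hW : MeasurableSet W) :
    Measurable (matchDecoder W : γ × (Fin M → α) → Fin M) := by
  have hmatch : Measurable fun (z : γ × (Fin M → α)) m => (z.2 m, z.1) ∈ W :=
    measurable_pi_lambda _ fun m => hW.mem.comp (by fun_prop)
  exact (Measurable.of_discrete (f := fun q : Fin M → Prop => Classical.epsilon q)).comp hmatch

end MatchDecoder

section RandomCoding

variable {U : Type} {A : Finset (UserPair U)} {In Out Msg : A → Type} {M : A → ℕ}
  {𝒳 𝒴 : UserPair U → Type} {I O : U → Type} {C S : Type}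
  [∀ p, MeasurableSpace (In p)] [∀ p, MeasurableSpace (Out p)] [∀ p, MeasurableSpace (Msg p)]
  [∀ p, MeasurableSpace (𝒳 p)] [∀ p, MeasurableSpace (𝒴 p)]
  [∀ i, MeasurableSpace (I i)] [∀ i, MeasurableSpace (O i)] [MeasurableSpace C]
  [MeasurableSpace S]

/-- The message modem which looks up the codewords of its messages in a codebook known to all users
as part of the common randomness, sends them by the modem `h`, and decodes by `δ` from the output of
`h` and the codewords of the pair. -/
noncomputable def Modem.withCodebook {i : U} (h : Modem A In Out 𝒳 𝒴 I O C i)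
    (δ : ∀ p, Out p × (Fin (M p) → In p) → Fin (M p)) (hδ : ∀ p, Measurable (δ p)) :
    Modem A (fun p => Fin (M p)) (fun p => Fin (M p)) 𝒳 𝒴 I O (C × Codebook M In) i where
  step k := (h.step k).comap
    (fun v => (fun p => v.2.2.1.2.codeword p.1 (v.1 p), v.2.1, v.2.2.1.1, v.2.2.2))
    (((measurable_codewords Subtype.val).comp (measurable_fst.prodMk (by fun_prop))).prodMk
      (by fun_prop))
  markov _ := inferInstance
  read p w := δ p.1 (h.read p (w.1, w.2.1), w.2.2.codeword p.1)
  measurable_read p := (hδ p.1).comp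
    (((h.measurable_read p).comp (by fun_prop)).prodMk (by fun_prop))

/-- The message modem with codewords from a codebook which decodes to a codeword that matches the
output of `h` in the sense of `W`. -/
noncomputable abbrev Modem.withMatchDecoder [∀ p, NeZero (M p)] {i : U}
    (h : Modem A In Out 𝒳 𝒴 I O C i) {W : ∀ p, Set (In p × Out p)}
    (hW : ∀ p, MeasurableSet (W p)) :
    Modem A (fun p => Fin (M p)) (fun p => Fin (M p)) 𝒳 𝒴 I O (C × Codebook M In) i :=
  h.withCodebook (fun p => matchDecoder (W p)) fun p => measurable_matchDecoder (hW p)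

/-- Puts the codewords in the place of the messages, and forgets the codebook. -/
def substituteCodewords (w : Primitive A (fun p => Fin (M p)) 𝒳 (C × Codebook M In) S) :
    Primitive A In 𝒳 C S :=
  (w.2.2.1.2.encode w.1, w.2.1, w.2.2.1.1, w.2.2.2)

lemma measurable_substituteCodewords :
    Measurable (substituteCodewords :
      Primitive A (fun p => Fin (M p)) 𝒳 (C × Codebook M In) S → Primitive A In 𝒳 C S) :=
  (measurable_encode.comp (measurable_fst.prodMk (by fun_prop))).prodMk (by fun_prop)

lemma measurable_unaffected :
    Measurable (unaffected : Realization A In 𝒳 𝒴 I O C S → _) := by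
  unfold unaffected reproduction mediumInput mediumOutput
  fun_prop

lemma measurable_decoded (h : ∀ i, Modem A In Out 𝒳 𝒴 I O C i) (p : A) :
    Measurable (decoded h p : Realization A In 𝒳 𝒴 I O C S → _) := by
  unfold decoded reproduction
  exact ((h p.1.dst).measurable_read ⟨p, rfl⟩).comp (by fun_prop)

lemma measurable_data_decoded (h : ∀ i, Modem A In Out 𝒳 𝒴 I O C i) (p : A) :
    Measurable fun w : Realization A In 𝒳 𝒴 I O C S => (w.1.1 p, decoded h p w) :=
  (by fun_prop : Measurable fun w : Realization A In 𝒳 𝒴 I O C S => w.1.1 p).prodMk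
    (measurable_decoded h p)

lemma measurable_encodeData [∀ p, DiscreteMeasurableSpace (In p)] (enc : ∀ p, In p → Msg p) :
    Measurable (Pi.map enc) :=
  measurable_pi_lambda _ fun p => Measurable.of_discrete.comp (measurable_pi_apply p)

lemma map_mediumInput_eq_of_map_unaffected_eq {In' : A → Type} {C' : Type}
    [∀ p, MeasurableSpace (In' p)] [MeasurableSpace C']
    {Λ : Measure (Realization A In 𝒳 𝒴 I O C S)} {Λ' : Measure (Realization A In' 𝒳 𝒴 I O C' S)}
    (hΛ : Λ.map unaffected = Λ'.map unaffected) (i : U) :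
    Λ.map (mediumInput i) = Λ'.map (mediumInput i) := by
  have hmap := congrArg (Measure.map fun z => (z.2 i).1) hΛ
  rwa [Measure.map_map (by fun_prop) measurable_unaffected,
    Measure.map_map (by fun_prop) measurable_unaffected] at hmap

variable [Fintype U] (m : Medium I O S) (h : ∀ i, Modem A In Out 𝒳 𝒴 I O C i)
  {δ : ∀ p, Out p × (Fin (M p) → In p) → Fin (M p)} (hδ : ∀ p, Measurable (δ p))
  (g : ∀ i, Modem A Msg Msg 𝒳 𝒴 I O C i) (enc : ∀ p, In p → Msg p) (dec : ∀ p, Msg p → Out p)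

lemma run_systemStep_withCodebook :
    run (systemStep (fun i => (h i).withCodebook δ hδ) m) =
      (run (systemStep h m)).comap substituteCodewords measurable_substituteCodewords := by
  refine run_eq_comap _ fun k => ?_
  ext1 w
  simp only [systemStep, Kernel.comap_apply, Kernel.prod_apply]
  rfl

lemma run_systemStep_withSourceCode [∀ p, DiscreteMeasurableSpace (In p)]
    [∀ p, DiscreteMeasurableSpace (Msg p)] :
    run (systemStep (fun i => (g i).withSourceCode enc dec) m) =
      (run (systemStep g m)).comap (Prod.map (Pi.map enc) id)
        ((measurable_encodeData enc).prodMap measurable_id) := by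
  refine run_eq_comap _ fun k => ?_
  ext1 w
  simp only [systemStep, Kernel.comap_apply, Kernel.prod_apply]
  rfl

variable [DecidableEq U] (β : Measure (∀ p, In p)) [IsProbabilityMeasure β]
  (ν : ∀ p : {p : UserPair U // p ∉ A}, Measure (ℤ → 𝒳 p.1)) [∀ p, IsProbabilityMeasure (ν p)]
  (κ : Measure C) [IsProbabilityMeasure κ]

instance : IsProbabilityMeasure (systemLaw h m β ν κ) :=
  inferInstanceAs (IsProbabilityMeasure (_ ⊗ₘ _))

lemma map_systemLaw_data : (systemLaw h m β ν κ).map (fun w => w.1.1) = β := by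
  have hfst := Measure.fst_compProd (β.prod ((Measure.pi ν).prod (κ.prod m.init)))
    (run (systemStep h m))
  exact (Measure.map_map measurable_fst measurable_fst).symm.trans
    ((congrArg Measure.fst hfst).trans Measure.fst_prod)

lemma ae_systemLaw_dirac_data_eq [∀ p, MeasurableSingletonClass (In p)] (b : ∀ p, In p) :
    ∀ᵐ w ∂systemLaw h m (Measure.dirac b) ν κ, w.1.1 = b := by
  refine ae_of_ae_map (p := (· = b))
    (f := fun w : Realization A In 𝒳 𝒴 I O C S => w.1.1) (by fun_prop) ?_
  rw [map_systemLaw_data, ae_dirac_eq]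
  exact rfl

lemma systemLaw_apply_eq_lintegral {E : Set (Realization A In 𝒳 𝒴 I O C S)}
    (hE : MeasurableSet E) :
    systemLaw h m β ν κ E = ∫⁻ b, systemLaw h m (Measure.dirac b) ν κ E ∂β := by
  have hmeas := Kernel.measurable_kernel_prodMk_left (κ := run (systemStep h m)) hE
  rw [systemLaw, Measure.compProd_apply hE, lintegral_prod _ hmeas.aemeasurable]
  refine lintegral_congr fun b => ?_
  rw [systemLaw, Measure.compProd_apply hE, Measure.dirac_prod, lintegral_map hmeas (by fun_prop)]

lemma map_systemLaw_withSourceCode [∀ p, DiscreteMeasurableSpace (In p)]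
    [∀ p, DiscreteMeasurableSpace (Msg p)] :
    (systemLaw (fun i => (g i).withSourceCode enc dec) m β ν κ).map
        (Prod.map (Prod.map (Pi.map enc) id) id) =
      systemLaw g m (β.map (Pi.map enc)) ν κ := by
  have henc := measurable_encodeData enc
  rw [systemLaw, run_systemStep_withSourceCode, map_compProd_comap,
    ← Measure.map_prod_map _ _ henc measurable_id, Measure.map_id, systemLaw]

lemma map_unaffected_withSourceCode [∀ p, DiscreteMeasurableSpace (In p)]
    [∀ p, DiscreteMeasurableSpace (Msg p)] :
    (systemLaw (fun i => (g i).withSourceCode enc dec) m β ν κ).map unaffected =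
      (systemLaw g m (β.map (Pi.map enc)) ν κ).map unaffected := by
  rw [← map_systemLaw_withSourceCode m g enc dec, Measure.map_map measurable_unaffected
    (((measurable_encodeData enc).prodMap measurable_id).prodMap measurable_id)]
  rfl

variable (ζ : ∀ p, Measure (In p)) [∀ p, IsProbabilityMeasure (ζ p)]

section Codewords

variable (b : Measure (∀ p, Fin (M p))) [IsProbabilityMeasure b]

lemma map_systemLaw_withCodebook :
    (systemLaw (fun i => (h i).withCodebook δ hδ) m b ν (κ.prod (codebookLaw M ζ))).map
      (Prod.map substituteCodewords id) = systemLaw h m (Measure.pi ζ) ν κ := by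
  rw [systemLaw, run_systemStep_withCodebook, map_compProd_comap, systemLaw]
  congr 1
  exact map_prod_substitute b _ κ _ _ (measurePreserving_encode ζ b)

lemma map_unaffected_withCodebook :
    (systemLaw (fun i => (h i).withCodebook δ hδ) m b ν (κ.prod (codebookLaw M ζ))).map
      unaffected = (systemLaw h m (Measure.pi ζ) ν κ).map unaffected := by
  rw [← map_systemLaw_withCodebook m h hδ ν κ ζ b, Measure.map_map measurable_unaffected
    (measurable_substituteCodewords.prodMap measurable_id)]
  rfl

lemma systemLaw_withCodebook_notMem {p : A} {W : Set (In p × Out p)} (hW : MeasurableSet W) :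
    systemLaw (fun i => (h i).withCodebook δ hδ) m b ν (κ.prod (codebookLaw M ζ))
        {w | (w.1.2.2.1.2.codeword p (w.1.1 p),
          decoded h p (Prod.map substituteCodewords id w)) ∉ W} =
      systemLaw h m (Measure.pi ζ) ν κ {w | (w.1.1 p, decoded h p w) ∉ W} := by
  have hmiss : MeasurableSet {w : Realization A In 𝒳 𝒴 I O C S | (w.1.1 p, decoded h p w) ∉ W} :=
    measurable_data_decoded h p hW.compl
  rw [← map_systemLaw_withCodebook m h hδ ν κ ζ b,
    Measure.map_apply (measurable_substituteCodewords.prodMap measurable_id) hmiss]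
  rfl

end Codewords

variable {msg : ∀ p, Fin (M p)} {p : A} {m' : Fin (M p)}

lemma map_systemLaw_withCodebook_prod (hm' : m' ≠ msg p) :
    (systemLaw (fun i => (h i).withCodebook δ hδ) m (Measure.dirac msg) ν
        (κ.prod (codebookLaw M ζ))).map
        (fun w => (w.1.2.2.1.2.codeword p m', Prod.map substituteCodewords id w)) =
      (ζ p).prod (systemLaw h m (Measure.pi ζ) ν κ) := by
  rw [systemLaw, run_systemStep_withCodebook, systemLaw]
  refine map_compProd_comap_prod _ _ _ _
    (u := fun w : Primitive A (fun p => Fin (M p)) 𝒳 (C × Codebook M In) S =>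
      w.2.2.1.2.codeword p m') (by fun_prop) _ ?_
  have hassoc := (measurePreserving_prodAssoc (ζ p) (Measure.pi ζ)
    ((Measure.pi ν).prod (κ.prod m.init))).map_eq
  rw [← hassoc, ← map_prod_substitute (Measure.dirac msg) _ κ _ _
    (measurePreserving_prodMk_encode ζ hm'), Measure.map_map]
  · rfl
  · exact MeasurableEquiv.prodAssoc.measurable
  · exact (Measurable.prodMk (Measurable.prodMk (by fun_prop) (measurable_encode.comp
      (measurable_fst.prodMk (by fun_prop)))) (by fun_prop))

lemma systemLaw_withCodebook_confusion_le (hm' : m' ≠ msg p) {W : Set (In p × Out p)}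
    (hW : MeasurableSet W) :
    systemLaw (fun i => (h i).withCodebook δ hδ) m (Measure.dirac msg) ν (κ.prod (codebookLaw M ζ))
        {w | (w.1.2.2.1.2.codeword p m', decoded h p (Prod.map substituteCodewords id w)) ∈ W} ≤
      ⨆ y, ζ p {x | (x, y) ∈ W} := by
  let matched : Set (In p × Realization A In 𝒳 𝒴 I O C S) := {z | (z.1, decoded h p z.2) ∈ W}
  have hmatched : MeasurableSet matched :=
    hW.preimage (measurable_fst.prodMk ((measurable_decoded h p).comp measurable_snd))
  refine (Measure.le_map_apply (Measurable.prodMk (by fun_prop)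
    (measurable_substituteCodewords.prodMap measurable_id)).aemeasurable matched).trans ?_
  rw [map_systemLaw_withCodebook_prod m h hδ ν κ ζ hm', Measure.prod_apply_symm hmatched]
  exact (lintegral_le_iSup _).trans
    (iSup_le fun w => le_iSup (fun y => ζ p {x | (x, y) ∈ W}) (decoded h p w))

lemma systemLaw_withCodebook_exists_confusion_le (msg : ∀ p, Fin (M p)) {p : A}
    {W : Set (In p × Out p)} (hW : MeasurableSet W) :
    systemLaw (fun i => (h i).withCodebook δ hδ) m (Measure.dirac msg) ν (κ.prod (codebookLaw M ζ))
        {w | ∃ m' ≠ msg p,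
          (w.1.2.2.1.2.codeword p m', decoded h p (Prod.map substituteCodewords id w)) ∈ W} ≤
      M p * ⨆ y, ζ p {x | (x, y) ∈ W} := by
  set Λ := systemLaw (fun i => (h i).withCodebook δ hδ) m (Measure.dirac msg) ν
    (κ.prod (codebookLaw M ζ))
  let matching (m' : Fin (M p)) : Set (Realization A (fun p => Fin (M p)) 𝒳 𝒴 I O _ S) :=
    {w | (w.1.2.2.1.2.codeword p m', decoded h p (Prod.map substituteCodewords id w)) ∈ W}
  calc Λ {w | ∃ m' ≠ msg p, w ∈ matching m'}
      ≤ Λ (⋃ m' ∈ Finset.univ.erase (msg p), matching m') :=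
        measure_mono fun w ⟨m', hm', hw⟩ => Set.mem_iUnion₂.2 ⟨m', by simpa using hm', hw⟩
    _ ≤ ∑ m' ∈ Finset.univ.erase (msg p), Λ (matching m') := measure_biUnion_finset_le _ _
    _ ≤ ∑ _m' ∈ Finset.univ.erase (msg p), ⨆ y, ζ p {x | (x, y) ∈ W} :=
        Finset.sum_le_sum fun m' hm' =>
          systemLaw_withCodebook_confusion_le m h hδ ν κ ζ (Finset.ne_of_mem_erase hm') hW
    _ ≤ ∑ _m' : Fin (M p), ⨆ y, ζ p {x | (x, y) ∈ W} :=
        Finset.sum_le_sum_of_subset (Finset.erase_subset _ _)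
    _ = M p * ⨆ y, ζ p {x | (x, y) ∈ W} := by simp

lemma systemLaw_withMatchDecoder_error_le [∀ p, NeZero (M p)] {W : ∀ p, Set (In p × Out p)}
    (hW : ∀ p, MeasurableSet (W p)) (msg : ∀ p, Fin (M p)) (p : A) :
    systemLaw (fun i => (h i).withMatchDecoder hW) m (Measure.dirac msg) ν
        (κ.prod (codebookLaw M ζ))
        {w | decoded (fun i => (h i).withMatchDecoder hW) p w ≠ msg p} ≤
      systemLaw h m (Measure.pi ζ) ν κ {w | (w.1.1 p, decoded h p w) ∉ W p} +
        M p * ⨆ y, ζ p {x | (x, y) ∈ W p} := by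
  rw [← systemLaw_withCodebook_notMem m h (fun p => measurable_matchDecoder (hW p)) ν κ ζ
    (Measure.dirac msg) (hW p)]
  refine (measure_mono_ae ?_).trans <| (measure_union_le _ _).trans <| add_le_add le_rfl <|
    systemLaw_withCodebook_exists_confusion_le m h _ ν κ ζ msg (hW p)
  filter_upwards [ae_systemLaw_dirac_data_eq m (fun i => (h i).withMatchDecoder hW) ν
    (κ.prod (codebookLaw M ζ)) msg] with w hw herror
  by_contra hmatch
  obtain ⟨hsent, hother⟩ := not_or.1 hmatch
  simp only [Set.mem_ofPred_eq, not_not, hw] at hsent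
  exact herror (matchDecoder_eq hsent fun m' hm' hw' => hother ⟨m', hm', hw'⟩)

section SourceCode

variable [∀ p, DiscreteMeasurableSpace (Msg p)] [∀ p, Countable (Msg p)]

lemma systemLaw_decoded_ne_le_iSup (b : Measure (∀ p, Msg p)) [IsProbabilityMeasure b] (p : A) :
    systemLaw g m b ν κ {w | decoded g p w ≠ w.1.1 p} ≤
      ⨆ msg, systemLaw g m (Measure.dirac msg) ν κ {w | decoded g p w ≠ msg p} := by
  have hwrong : MeasurableSet {w : Realization A Msg 𝒳 𝒴 I O C S | decoded g p w ≠ w.1.1 p} :=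
    (measurableSet_eq_fun (measurable_decoded g p) (by fun_prop)).compl
  rw [systemLaw_apply_eq_lintegral m g b ν κ hwrong]
  refine (lintegral_le_iSup _).trans (iSup_mono fun msg => measure_mono_ae ?_)
  filter_upwards [ae_systemLaw_dirac_data_eq m g ν κ msg] with w hw hne
  rw [← hw]
  exact hne

lemma systemLaw_withSourceCode_le [∀ p, DiscreteMeasurableSpace (In p)] (p : A)
    (E : Set (In p × Out p)) :
    systemLaw (fun i => (g i).withSourceCode enc dec) m β ν κ
        {w | (w.1.1 p, decoded (fun i => (g i).withSourceCode enc dec) p w) ∈ E} ≤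
      (⨆ msg, systemLaw g m (Measure.dirac msg) ν κ {w | decoded g p w ≠ msg p}) +
        β {x | (x p, dec p (enc p (x p))) ∈ E} := by
  have henc := measurable_encodeData enc
  let encodeData : Realization A In 𝒳 𝒴 I O C S → Realization A Msg 𝒳 𝒴 I O C S :=
    Prod.map (Prod.map (Pi.map enc) id) id
  have hencodeData : Measurable encodeData := (henc.prodMap measurable_id).prodMap measurable_id
  have hsub : {w | (w.1.1 p, decoded (fun i => (g i).withSourceCode enc dec) p w) ∈ E} ⊆
      encodeData ⁻¹' {w | decoded g p w ≠ w.1.1 p} ∪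
        (fun w => w.1.1) ⁻¹' {x | (x p, dec p (enc p (x p))) ∈ E} := by
    refine fun w hw => or_iff_not_imp_left.2 fun hdec => ?_
    have hcorrect : decoded g p (encodeData w) = enc p (w.1.1 p) := not_not.1 hdec
    change (w.1.1 p, dec p (decoded g p (encodeData w))) ∈ E at hw
    rwa [hcorrect] at hw
  have := Measure.isProbabilityMeasure_map (μ := β) henc.aemeasurable
  refine (measure_mono hsub).trans ((measure_union_le _ _).trans (add_le_add ?_ ?_))
  · refine (Measure.le_map_apply hencodeData.aemeasurable _).trans ?_
    rw [map_systemLaw_withSourceCode m g enc dec]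
    exact systemLaw_decoded_ne_le_iSup m g ν κ _ p
  · refine (Measure.le_map_apply (by fun_prop) _).trans_eq ?_
    rw [map_systemLaw_data]

end SourceCode

end RandomCoding

/-! ### Separation -/

section Separation

variable {U : Type} {A : Finset (UserPair U)} {In Out : A → Type} {M : A → ℕ}
  {𝒳 𝒴 : UserPair U → Type} {I O : U → Type} {C S : Type}
  [∀ p, MeasurableSpace (In p)] [∀ p, DiscreteMeasurableSpace (In p)]
  [∀ p, MeasurableSpace (Out p)] [∀ p, MeasurableSpace (𝒳 p)] [∀ p, MeasurableSpace (𝒴 p)]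
  [∀ i, MeasurableSpace (I i)] [∀ i, MeasurableSpace (O i)] [MeasurableSpace C]
  [MeasurableSpace S]
  {δ : ∀ p, Out p × (Fin (M p) → In p) → Fin (M p)} (hδ : ∀ p, Measurable (δ p))
  (enc : ∀ p, In p → Fin (M p)) (dec : ∀ p, Fin (M p) → Out p)

lemma Modem.step_withCodebook_withSourceCode_of_forall_src_ne {i : U}
    (h : Modem A In Out 𝒳 𝒴 I O C i) (hi : ∀ p ∈ A, p.src ≠ i) (k : ℕ)
    (b : ∀ p : {p : A // p.1.src = i}, In p.1) (x) (c : C) (c' : Codebook M In) (o y) :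
    ((h.withCodebook δ hδ).withSourceCode enc dec).step k (b, x, (c, c'), o, y) =
      h.step k (b, x, c, o, y) :=
  congrArg (fun b => h.step k (b, x, c, o, y)) <|
    funext fun p => absurd p.2 (hi p.1.1 p.1.2)

variable [Fintype U] [DecidableEq U] (m : Medium I O S) (h : ∀ i, Modem A In Out 𝒳 𝒴 I O C i)
  (β : Measure (∀ p, In p)) [IsProbabilityMeasure β]
  (ν : ∀ p : {p : UserPair U // p ∉ A}, Measure (ℤ → 𝒳 p.1)) [∀ p, IsProbabilityMeasure (ν p)]
  (κ : Measure C) [IsProbabilityMeasure κ] (ζ : ∀ p, Measure (In p))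
  [∀ p, IsProbabilityMeasure (ζ p)]

lemma map_unaffected_withCodebook_withSourceCode :
    (systemLaw (fun i => ((h i).withCodebook δ hδ).withSourceCode enc dec) m β ν
      (κ.prod (codebookLaw M ζ))).map unaffected =
      (systemLaw h m (Measure.pi ζ) ν κ).map unaffected := by
  have := Measure.isProbabilityMeasure_map (μ := β) (measurable_encodeData enc).aemeasurable
  rw [map_unaffected_withSourceCode, map_unaffected_withCodebook]

end Separation

section Communication

variable {U : Type} [Fintype U] [DecidableEq U] {A : Finset (UserPair U)}
  {𝒳 𝒴 : UserPair U → Type} {I O : U → Type} {C : ℕ → Type} {S : Type}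
  [∀ p, MeasurableSpace (𝒳 p)] [∀ p, MeasurableSpace (𝒴 p)]
  [∀ i, MeasurableSpace (I i)] [∀ i, MeasurableSpace (O i)] [∀ n, MeasurableSpace (C n)]
  [MeasurableSpace S] {h : ∀ n i, SourceModem A 𝒳 𝒴 I O (C n) n i} {m : Medium I O S}
  {μ : ∀ p : A, Measure (𝒳 p.1)} [∀ p, IsProbabilityMeasure (μ p)]
  {ν : ∀ p : {p : UserPair U // p ∉ A}, Measure (ℤ → 𝒳 p.1)} [∀ p, IsProbabilityMeasure (ν p)]
  {κ : ∀ n, Measure (C n)} [∀ n, IsProbabilityMeasure (κ n)] {p : A}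

variable (h m μ ν κ p) in
lemma map_sourceLaw_block (n : ℕ) :
    (sourceLaw (h n) m μ ν (κ n)).map (fun w => w.1.1 p) =
      Measure.pi fun _ : Fin n => μ p := by
  rw [← (measurePreserving_eval (fun p : A => Measure.pi fun _ : Fin n => μ p) p).map_eq,
    ← map_systemLaw_data m (h n) (Measure.pi fun p => Measure.pi fun _ : Fin n => μ p) ν (κ n),
    Measure.map_map (measurable_pi_apply p) (by fun_prop)]
  rfl

lemma CommunicatesWithin.isReproducible [Countable (𝒳 p.1)] [DiscreteMeasurableSpace (𝒳 p.1)]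
    {d : 𝒳 p.1 → 𝒴 p.1 → ℝ≥0} {D : ℝ} (hcomm : CommunicatesWithin h m μ ν κ p d D) :
    IsReproducible (μ p) d D := by
  refine tendsto_of_tendsto_of_tendsto_of_le_of_le tendsto_const_nhds hcomm
    (fun _ => zero_le) fun n => ?_
  dsimp only
  rw [← map_sourceLaw_block h m μ ν κ p n, Measure.map_apply (by fun_prop) (.of_discrete)]
  exact measure_mono fun w hw => hw _

lemma CommunicatesWithin.tendsto_notMem_typical {d : 𝒳 p.1 → 𝒴 p.1 → ℝ≥0} {D : ℝ}
    (hcomm : CommunicatesWithin h m μ ν κ p d D) {T : ∀ n, Set (Fin n → 𝒳 p.1)}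
    (hT : Tendsto (fun n => (Measure.pi fun _ : Fin n => μ p) (T n)ᶜ) atTop (𝓝 0)) :
    Tendsto (fun n => sourceLaw (h n) m μ ν (κ n)
      {w | ¬ (w.1.1 p ∈ T n ∧ avgDistortion d (w.1.1 p) (decoded (h n) p w) ≤ D)})
      atTop (𝓝 0) := by
  refine tendsto_of_tendsto_of_tendsto_of_le_of_le tendsto_const_nhds
    (by simpa only [add_zero] using hT.add hcomm) (fun _ => zero_le) fun n => ?_
  simp only [not_and_or, not_le, Set.ofPred_or]
  refine (measure_union_le _ _).trans (add_le_add ?_ le_rfl)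
  rw [← map_sourceLaw_block h m μ ν κ p n]
  exact Measure.le_map_apply (by fun_prop) _

lemma communicatesReliably_withMatchDecoder {M : ℕ → A → ℕ} [∀ n p, NeZero (M n p)]
    {W : ∀ n (p : A), Set ((Fin n → 𝒳 p.1) × (Fin n → 𝒴 p.1))}
    (hW : ∀ n p, MeasurableSet (W n p))
    (hmiss : Tendsto (fun n => sourceLaw (h n) m μ ν (κ n)
      {w | (w.1.1 p, decoded (h n) p w) ∉ W n p}) atTop (𝓝 0))
    (hconfusion : Tendsto (fun n => (M n p : ℝ≥0∞) *
      ⨆ y, (Measure.pi fun _ : Fin n => μ p) {x | (x, y) ∈ W n p}) atTop (𝓝 0)) :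
    CommunicatesReliably (M := M) (fun n i => (h n i).withMatchDecoder (hW n)) m ν
      (fun n => (κ n).prod (codebookLaw (M n) fun p => Measure.pi fun _ : Fin n => μ p)) p := by
  refine tendsto_of_tendsto_of_tendsto_of_le_of_le tendsto_const_nhds
    (by simpa only [add_zero] using hmiss.add hconfusion) (fun _ => zero_le) fun n => ?_
  exact iSup_le fun msg => systemLaw_withMatchDecoder_error_le m (h n) ν (κ n) _ (hW n) msg p

lemma CommunicatesReliably.communicatesWithin_withSourceCode [∀ p : A, Countable (𝒳 p.1)]
    [∀ p : A, DiscreteMeasurableSpace (𝒳 p.1)] {M : ℕ → A → ℕ}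
    {g : ∀ n i, MessageModem A 𝒳 𝒴 I O (C n) (M n) i} (hg : CommunicatesReliably g m ν κ p)
    {enc : ∀ (p : A) n, (Fin n → 𝒳 p.1) → Fin (M n p)}
    {dec : ∀ (p : A) n, Fin (M n p) → Fin n → 𝒴 p.1} {d : 𝒳 p.1 → 𝒴 p.1 → ℝ≥0} {D : ℝ}
    (hcode : CompressesWithin (μ p) d D (enc p) (dec p)) :
    CommunicatesWithin
      (fun n i => (g n i).withSourceCode (fun p => enc p n) fun p => dec p n) m μ ν κ p d D := by
  refine tendsto_of_tendsto_of_tendsto_of_le_of_le tendsto_const_nhds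
    (by simpa only [add_zero] using hg.add hcode) (fun _ => zero_le) fun n => ?_
  refine (systemLaw_withSourceCode_le m (g n) (fun p => enc p n) (fun p => dec p n) _ ν (κ n) p
    {z | D < avgDistortion d z.1 z.2}).trans (add_le_add le_rfl ?_)
  rw [← (measurePreserving_eval (fun p : A => Measure.pi fun _ : Fin n => μ p) p).map_eq]
  exact Measure.le_map_apply (measurable_pi_apply p).aemeasurable _

end Communication

end UnknownNetwork

theorem mainTheorem1_general {U : Type} [Fintype U] [DecidableEq U]
    {𝒳 𝒴 : UserPair U → Type} {I O : U → Type}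
    [∀ p, MeasurableSpace (𝒳 p)] [∀ p, MeasurableSpace (𝒴 p)]
    [∀ i, MeasurableSpace (I i)] [∀ i, MeasurableSpace (O i)]
    {C : ℕ → Type} [∀ n, MeasurableSpace (C n)] (κ : ∀ n, Measure (C n))
    [∀ n, IsProbabilityMeasure (κ n)] (A : Finset (UserPair U))
    [∀ p : A, Finite (𝒳 p.1)] [∀ p : A, DiscreteMeasurableSpace (𝒳 p.1)]
    [∀ p : A, Finite (𝒴 p.1)] [∀ p : A, DiscreteMeasurableSpace (𝒴 p.1)]
    (μ : ∀ p : A, Measure (𝒳 p.1)) [∀ p, IsProbabilityMeasure (μ p)]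
    (ν : ∀ p : {p : UserPair U // p ∉ A}, Measure (ℤ → 𝒳 p.1)) [∀ p, IsProbabilityMeasure (ν p)]
    (d : ∀ p : A, 𝒳 p.1 → 𝒴 p.1 → ℝ≥0) (D D' : A → ℝ)
    (hR : ∀ p, rateDistortion (μ p) (d p) (D' p) < rateDistortion (μ p) (d p) (D p))
    (h : ∀ n i, SourceModem A 𝒳 𝒴 I O (C n) n i) :
    ∃ (C' : ℕ → Type) (_ : ∀ n, MeasurableSpace (C' n)) (κ' : ∀ n, Measure (C' n))
      (_ : ∀ n, IsProbabilityMeasure (κ' n)) (R : A → ℝ≥0)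
      (enc : ∀ (p : A) (n : ℕ), (Fin n → 𝒳 p.1) → Fin (msgCount (R p) n))
      (dec : ∀ (p : A) (n : ℕ), Fin (msgCount (R p) n) → (Fin n → 𝒴 p.1))
      (g : ∀ n i, MessageModem A 𝒳 𝒴 I O (C n × C' n) (fun p => msgCount (R p) n) i)
      (h' : ∀ n i, SourceModem A 𝒳 𝒴 I O (C n × C' n) n i),
      (∀ p, rateDistortion (μ p) (d p) (D' p) < R p ∧ R p < rateDistortion (μ p) (d p) (D p)) ∧
      (∀ p, CompressesWithin (μ p) (d p) (D' p) (enc p) (dec p)) ∧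
      (∀ n i, h' n i = (g n i).withSourceCode (fun p => enc p n) (fun p => dec p n)) ∧
      (∀ n i, (∀ p ∈ A, p.src ≠ i ∧ p.dst ≠ i) → ∀ k b x c c' o y,
        (h' n i).step k (b, x, (c, c'), o, y) = (h n i).step k (b, x, c, o, y)) ∧
      ∀ (S : Type) [MeasurableSpace S] (m : Medium I O S),
        (∀ p, CommunicatesWithin h m μ ν κ p (d p) (D p)) →
        (∀ p, CommunicatesReliably g m ν (fun n => (κ n).prod (κ' n)) p) ∧
        (∀ p, CommunicatesWithin h' m μ ν (fun n => (κ n).prod (κ' n)) p (d p) (D' p)) ∧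
        (∀ n i, (sourceLaw (h' n) m μ ν ((κ n).prod (κ' n))).map (mediumInput i) =
          (sourceLaw (h n) m μ ν (κ n)).map (mediumInput i)) ∧
        (∀ n, (sourceLaw (h' n) m μ ν ((κ n).prod (κ' n))).map unaffected =
          (sourceLaw (h n) m μ ν (κ n)).map unaffected) := by
  choose R hD'R hRD using fun p => ENNReal.lt_iff_exists_nnreal_btwn.1 (hR p)
  choose enc dec hcode using fun p => isAchievableRate_of_rateDistortion_lt (hD'R p)
  choose T hT hpacking using fun p => exists_packing (hRD p)
  let M (n : ℕ) (p : A) := msgCount (R p) n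
  let W (n : ℕ) (p : A) : Set ((Fin n → 𝒳 p.1) × (Fin n → 𝒴 p.1)) :=
    {z | z.1 ∈ T p n ∧ avgDistortion (d p) z.1 z.2 ≤ D p}
  have hW (n : ℕ) (p : A) : MeasurableSet (W n p) := .of_discrete
  let κ' (n : ℕ) := codebookLaw (M n) fun p => Measure.pi fun _ : Fin n => μ p
  let g n i := (h n i).withMatchDecoder (M := M n) (hW n)
  refine ⟨_, fun _ => inferInstance, κ', fun _ => inferInstance, R, enc, dec, g, _,
    fun p => ⟨hD'R p, hRD p⟩, hcode, fun _ _ => rfl,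
    fun n i hi => (h n i).step_withCodebook_withSourceCode_of_forall_src_ne _ _ _
      fun p hp => (hi p hp).1, fun S _ m hcomm => ?_⟩
  have hreliable (p : A) : CommunicatesReliably g m ν (fun n => (κ n).prod (κ' n)) p :=
    communicatesReliably_withMatchDecoder hW ((hcomm p).tendsto_notMem_typical (hT p))
      (hpacking p (hcomm p).isReproducible)
  have hunaffected (n : ℕ) := map_unaffected_withCodebook_withSourceCode
    (fun p => measurable_matchDecoder (hW n p)) (fun p => enc p n) (fun p => dec p n) m (h n)
    (Measure.pi fun p => Measure.pi fun _ => μ p) ν (κ n) fun p => Measure.pi fun _ => μ p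
  exact ⟨hreliable, fun p => (hreliable p).communicatesWithin_withSourceCode (hcode p),
    fun n i => map_mediumInput_eq_of_map_unaffected_eq (hunaffected n) i, hunaffected⟩

theorem mainTheorem1 {U : Type} [Fintype U] [DecidableEq U]
    -- finite alphabets of the sources, their reproductions, the medium inputs and medium outputs
    {𝒳 𝒴 : UserPair U → Type} {I O : U → Type}
    [∀ p, Finite (𝒳 p)] [∀ p, MeasurableSpace (𝒳 p)] [∀ p, DiscreteMeasurableSpace (𝒳 p)]
    [∀ p, Finite (𝒴 p)] [∀ p, MeasurableSpace (𝒴 p)] [∀ p, DiscreteMeasurableSpace (𝒴 p)]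
    [∀ i, Finite (I i)] [∀ i, MeasurableSpace (I i)] [∀ i, DiscreteMeasurableSpace (I i)]
    [∀ i, Finite (O i)] [∀ i, MeasurableSpace (O i)] [∀ i, DiscreteMeasurableSpace (O i)]
    -- common randomness
    {C : ℕ → Type} [∀ n, MeasurableSpace (C n)] (κ : ∀ n, Measure (C n))
    [∀ n, IsProbabilityMeasure (κ n)]
    -- the marginals of the i.i.d. sources in `A`, the laws of the other sources
    (A : Finset (UserPair U)) (μ : ∀ p : A, Measure (𝒳 p.1)) [∀ p, IsProbabilityMeasure (μ p)]
    (ν : ∀ p : {p : UserPair U // p ∉ A}, Measure (ℤ → 𝒳 p.1)) [∀ p, IsProbabilityMeasure (ν p)]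
    (d : ∀ p : A, 𝒳 p.1 → 𝒴 p.1 → ℝ≥0) (D D' : A → ℝ) (hD : ∀ p, D p < D' p)
    (hR : ∀ p, rateDistortion (μ p) (d p) (D' p) < rateDistortion (μ p) (d p) (D p))
    -- the given modems
    (h : ∀ n i, SourceModem A 𝒳 𝒴 I O (C n) n i) :
    ∃ (C' : ℕ → Type) (_ : ∀ n, MeasurableSpace (C' n)) (κ' : ∀ n, Measure (C' n))
      (_ : ∀ n, IsProbabilityMeasure (κ' n)) (R : A → ℝ≥0)
      (enc : ∀ (p : A) (n : ℕ), (Fin n → 𝒳 p.1) → Fin (msgCount (R p) n))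
      (dec : ∀ (p : A) (n : ℕ), Fin (msgCount (R p) n) → (Fin n → 𝒴 p.1))
      (g : ∀ n i, MessageModem A 𝒳 𝒴 I O (C n × C' n) (fun p => msgCount (R p) n) i)
      (h' : ∀ n i, SourceModem A 𝒳 𝒴 I O (C n × C' n) n i),
      -- source coding to within `D'`, at a rate between `R(D')` and `R(D)`
      (∀ p, rateDistortion (μ p) (d p) (D' p) < R p ∧ R p < rateDistortion (μ p) (d p) (D p)) ∧
      (∀ p, CompressesWithin (μ p) (d p) (D' p) (enc p) (dec p)) ∧
      -- the new modems have the separation architecture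
      (∀ n i, h' n i = (g n i).withSourceCode (fun p => enc p n) (fun p => dec p n)) ∧
      -- the modem of a user which is in no pair of `A` is not changed
      (∀ n i, (∀ p ∈ A, p.src ≠ i ∧ p.dst ≠ i) → ∀ k b x c c' o y,
        (h' n i).step k (b, x, (c, c'), o, y) = (h n i).step k (b, x, c, o, y)) ∧
      -- the new modems do not depend on the medium: the following holds for all media
      ∀ (S : Type) [MeasurableSpace S] (m : Medium I O S),
        (∀ p, CommunicatesWithin h m μ ν κ p (d p) (D p)) →
        -- the messages are communicated reliably
        (∀ p, CommunicatesReliably g m ν (fun n => (κ n).prod (κ' n)) p) ∧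
        -- end to end, the sources in `A` are communicated to within `D'`
        (∀ p, CommunicatesWithin h' m μ ν (fun n => (κ n).prod (κ' n)) p (d p) (D' p)) ∧
        -- energy and bandwidth use, which are functions of the law of the medium input of a user
        (∀ n i, (sourceLaw (h' n) m μ ν ((κ n).prod (κ' n))).map (mediumInput i) =
          (sourceLaw (h n) m μ ν (κ n)).map (mediumInput i)) ∧
        -- every other source is received as before, jointly in distribution
        (∀ n, (sourceLaw (h' n) m μ ν ((κ n).prod (κ' n))).map unaffected =
          (sourceLaw (h n) m μ ν (κ n)).map unaffected) :=
  mainTheorem1_general κ A μ ν d D D' hR h
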